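/- Let $\mathcal Q$ be a small quantaloid, i.e. a small category whose hom-sets are complete lattices and whose composition preserves suprema in each variable, with internal homs $\gamma\swarrow\alpha$ (the largest $\beta$ with $\beta\circ\alpha\le\gamma$) and $\beta\searrow\gamma$ (the largest $\alpha$ with $\beta\circ\alpha\le\gamma$). A $\mathcal Q$-category $X=(X,a)$ is a small set $X$ with a type map $|\cdot|:X\to\mathrm{ob}\,\mathcal Q$ and morphisms $a(x,y):|x|\to|y|$ with $1_{|x|}\le a(x,x)$ and $a(y,z)\circ a(x,y)\le a(x,z)$; $\mathcal Q$-functors $f:(X,a)\to(Y,b)$ are the type-preserving maps with $a(x,x')\le b(fx,fx')$, ordered by $f\le g\iff 1_{|x|}\le b(fx,gx)$ for all $x$; a $\mathcal Q$-distributor $\varphi:(X,a)\to(Y,b)$ is a family $\varphi(x,y):|x|\to|y|$ with $b\circ\varphi\circ a\le\varphi$, distributors being composed by $(\psi\circ\varphi)(x,z)=\bigvee_y\psi(y,z)\circ\varphi(x,y)$ and ordered pointwise. A $\mathcal Q$-functor $f$ gives distributors $f_*(x,y)=b(fx,y)$ and $f^*(y,x)=b(y,fx)$. This yields the 2-category $\mathcal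 Q\text{-}\mathbf{Cat}$ and the quantaloid $\mathcal Q\text{-}\mathbf{Dist}$. Let $\mathcal PX$ be the $\mathcal Q$-category of presheaves on $X$ (distributors $\sigma$ from $X$ to the one-object $\mathcal Q$-category $\{s\}$ with hom $1_s$; $|\sigma|=s$; hom $\tau\swarrow\sigma$), and $\mathcal P^\dagger X$ that of copresheaves (distributors from $\{s\}$ to $X$; hom $\tau\searrow\sigma$), with $\mathcal Pf(\sigma)=\sigma\circ f^*$, $\mathcal P^\dagger f(\sigma)=f_*\circ\sigma$, Yoneda functors $\mathsf y_X(x)=a(-,x)$ and $\mathsf y^\dagger_X(x)=a(x,-)$. For a distributor $\varphi:X\to Y$ put $\varphi^\odot(\tau)=\tau\circ\varphi$ on presheaves and $\varphi^\oplus(\sigma)=\varphi\circ\sigma$ on copresheaves. The double presheaf 2-monad is $(\mathcal P\mathcal P^\dagger,\mathfrak s,\mathfrak y)$ with $\mathfrak y_X=\mathsf y_{\mathcal P^\dagger X}\cdot\mathsf y^\dagger_X$ and $\mathfrak s_X=((\mathsf y^\dagger_{\mathcal P\mathcal P^\dagger X}\cdot\mathsf y_{\mathcal P^\dagger X})_*)^\odot$;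 the double copresheaf 2-monad is $(\mathcal P^\dagger\mathcal P,\mathfrak s^\dagger,\mathfrak y^\dagger)$ with $\mathfrak y^\dagger_X=\mathsf y^\dagger_{\mathcal PX}\cdot\mathsf y_X$ and $\mathfrak s^\dagger_X=((\mathsf y_{\mathcal P^\dagger\mathcal PX}\cdot\mathsf y^\dagger_{\mathcal PX})^*)^\oplus$. A presheaf $\sigma$ (copresheaf $\tau$) is conical if $\sigma=\bigvee_{x\in A}a(-,x)$ (resp. $\tau=\bigvee_{x\in A}a(x,-)$) for some set $A$ of objects of type $|\sigma|$ (resp. $|\tau|$); $\mathcal H$ and $\mathcal H^\dagger$ are the subfunctors of $\mathcal P$ and $\mathcal P^\dagger$ given by the conical presheaves and copresheaves with the inherited structure. A lax extension of a 2-functor $\mathcal T$ on $\mathcal Q\text{-}\mathbf{Cat}$ is a lax functor $\hat{\mathcal T}$ on $\mathcal Q\text{-}\mathbf{Dist}$ that agrees with $\mathcal T$ on objects and satisfies $(\mathcal Tf)_*\le\hat{\mathcal T}(f_*)$ and $(\mathcal Tf)^*\le\hat{\mathcal T}(f^*)$ for all $\mathcal Q$-functors $f$; it is flat if both are equalities.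 It is a lax extension of a 2-monad $(\mathcal T,\mathsf m,\mathsf e)$ if moreover $(\mathsf m_Y)_*\circ\hat{\mathcal T}\hat{\mathcal T}\varphi\le\hat{\mathcal T}\varphi\circ(\mathsf m_X)_*$ and $(\mathsf e_Y)_*\circ\varphi\le\hat{\mathcal T}\varphi\circ(\mathsf e_X)_*$ for all distributors $\varphi:X\to Y$. Put $\overline{\mathcal T}\varphi=(\mathcal T\overleftarrow\varphi)^*\circ(\mathcal T\mathsf y_X)_*$, where $\overleftarrow\varphi:Y\to\mathcal PX$, $y\mapsto\varphi(-,y)$. Theorem. Suppose that $\mathcal Q$ is completely distributive, i.e. every hom-lattice $\mathcal Q(p,q)$ is completely distributive. Then: (1) $\mathcal H\mathcal H^\dagger$ carries a 2-monad structure with unit $\mathsf y_{\mathcal H^\dagger X}\cdot\mathsf y^\dagger_X$ and multiplication $\Upsilon\mapsto\Upsilon\circ(\mathsf y^\dagger_{\mathcal H\mathcal H^\dagger X}\cdot\mathsf y_{\mathcal H^\dagger X})_*$ (with the Yoneda functors corestricted to conical (co)presheaves). The horizontal composite of the inclusions $\mathcal H^\dagger\to\mathcal P^\dagger$ and $\mathcal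 H\to\mathcal P$ makes it a sub-2-monad of $(\mathcal P\mathcal P^\dagger,\mathfrak s,\mathfrak y)$: it is a monad morphism with fully faithful, injective components. Moreover $\overline{\mathcal H\mathcal H^\dagger}$ is a lax extension of this 2-monad to $\mathcal Q\text{-}\mathbf{Dist}$, it is the unique flat lax extension of $\mathcal H\mathcal H^\dagger$, and $\overline{\mathcal H\mathcal H^\dagger}\varphi=\overline{\mathcal H}\,\overline{\mathcal H^\dagger}\varphi$ for every distributor $\varphi$. (2) $\mathcal H^\dagger\mathcal H$ carries a 2-monad structure with unit $\mathsf y^\dagger_{\mathcal HX}\cdot\mathsf y_X$ and multiplication $\Upsilon\mapsto(\mathsf y_{\mathcal H^\dagger\mathcal HX}\cdot\mathsf y^\dagger_{\mathcal HX})^*\circ\Upsilon$, and the horizontal composite of the inclusions makes it, in the same sense, a sub-2-monad of $(\mathcal P^\dagger\mathcal P,\mathfrak s^\dagger,\mathfrak y^\dagger)$. Moreover $\overline{\mathcal H^\dagger\mathcal H}$ is a lax extension of this 2-monad to $\mathcal Q\text{-}\mathbf{Dist}$, it is the unique flat lax extension of $\mathcal H^\dagger\mathcal H$, and $\overline{\mathcal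 H^\dagger\mathcal H}\varphi=\overline{\mathcal H^\dagger}\,\overline{\mathcal H}\varphi$ for every distributor $\varphi$. -/

import Mathlib

open CategoryTheory

universe u

namespace QEnr

/-- A small quantaloid: a small category whose hom-sets are complete lattices and whose composition
preserves arbitrary suprema in each variable. Composition is written in diagrammatic order, so
`f ≫ g` is `g ∘ f`. -/
class Quantaloid (Q : Type u) extends SmallCategory Q where
  [lat : ∀ p q : Q, CompleteLattice (p ⟶ q)]
  sSup_comp : ∀ {p q r : Q} (S : Set (p ⟶ q)) (g : q ⟶ r), sSup S ≫ g = ⨆ f ∈ S, f ≫ g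
  comp_sSup : ∀ {p q r : Q} (f : p ⟶ q) (S : Set (q ⟶ r)), f ≫ sSup S = ⨆ g ∈ S, f ≫ g

attribute [reducible, instance] Quantaloid.lat

variable {Q : Type u} [Quantaloid Q]

theorem iSup_comp {p q r : Q} {ι : Sort*} (f : ι → (p ⟶ q)) (g : q ⟶ r) :
    (⨆ i, f i) ≫ g = ⨆ i, f i ≫ g := by
  rw [iSup, Quantaloid.sSup_comp, iSup_range]

theorem comp_iSup {p q r : Q} {ι : Sort*} (f : p ⟶ q) (g : ι → (q ⟶ r)) :
    f ≫ (⨆ i, g i) = ⨆ i, f ≫ g i := by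
  rw [iSup, Quantaloid.comp_sSup, iSup_range]

theorem comp_mono {p q r : Q} {f f' : p ⟶ q} {g g' : q ⟶ r} (hf : f ≤ f') (hg : g ≤ g') :
    f ≫ g ≤ f' ≫ g' := by
  have h1 : f ≫ g ≤ f' ≫ g := by
    have := Quantaloid.sSup_comp ({f, f'} : Set (p ⟶ q)) g
    rw [sSup_pair, sup_eq_right.2 hf] at this
    rw [this]
    exact le_iSup₂_of_le f (by simp) le_rfl
  have h2 : f' ≫ g ≤ f' ≫ g' := by
    have := Quantaloid.comp_sSup f' ({g, g'} : Set (q ⟶ r))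
    rw [sSup_pair, sup_eq_right.2 hg] at this
    rw [this]
    exact le_iSup₂_of_le g (by simp) le_rfl
  exact h1.trans h2

variable (Q) in
/-- `Q` is completely distributive: every hom-lattice satisfies the complete distributive law. -/
def IsCompletelyDistributive : Prop :=
  ∀ (p q : Q) (I : Type u) (J : I → Type u) (f : ∀ i, J i → (p ⟶ q)),
    ⨅ i, ⨆ j, f i j = ⨆ s : ∀ i, J i, ⨅ i, f i (s i)

/-- The internal hom `γ ↙ α`: the largest `β` with `β ∘ α ≤ γ`. -/
def lres {p q r : Q} (γ : p ⟶ r) (α : p ⟶ q) : q ⟶ r := sSup {β | α ≫ β ≤ γ}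

/-- The internal hom `β ↘ γ`: the largest `α` with `β ∘ α ≤ γ`. -/
def rres {p q r : Q} (β : q ⟶ r) (γ : p ⟶ r) : p ⟶ q := sSup {α | α ≫ β ≤ γ}

theorem le_lres {p q r : Q} {γ : p ⟶ r} {α : p ⟶ q} {β : q ⟶ r} :
    β ≤ lres γ α ↔ α ≫ β ≤ γ := by
  refine ⟨fun h => (comp_mono le_rfl h).trans ?_, fun h => le_sSup h⟩
  rw [lres, Quantaloid.comp_sSup]
  exact iSup₂_le fun _ h => h

theorem le_rres {p q r : Q} {γ : p ⟶ r} {α : p ⟶ q} {β : q ⟶ r} :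
    α ≤ rres β γ ↔ α ≫ β ≤ γ := by
  refine ⟨fun h => (comp_mono h le_rfl).trans ?_, fun h => le_sSup h⟩
  rw [rres, Quantaloid.sSup_comp]
  exact iSup₂_le fun _ h => h

/-! ### `Q`-categories and `Q`-functors -/

variable (Q) in
/-- A small `Q`-category. The set of objects over `Q₀` is given by its fibres: `X.fib q` is the set
of objects of type (array) `q`, so the underlying set is `Σ q, X.fib q` and the type map is the first
projection. `X.hom x y` is `a(x, y) : |x| → |y|`. -/
structure QCat where
  fib : Q → Type u
  hom : ∀ {p q : Q}, fib p → fib q → (p ⟶ q)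
  id_le : ∀ {p : Q} (x : fib p), 𝟙 p ≤ hom x x
  comp_le : ∀ {p q r : Q} (x : fib p) (y : fib q) (z : fib r), hom x y ≫ hom y z ≤ hom x z

/-- A `Q`-functor: a type-preserving map with `a(x, x') ≤ b(f x, f x')`. -/
@[ext]
structure QFunctor (X Y : QCat Q) where
  map : ∀ {q : Q}, X.fib q → Y.fib q
  hom_le : ∀ {p q : Q} (x : X.fib p) (x' : X.fib q), X.hom x x' ≤ Y.hom (map x) (map x')

instance : Category (QCat Q) where
  Hom X Y := QFunctor X Y
  id X := ⟨fun x => x, fun _ _ => le_rfl⟩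
  comp f g := ⟨fun x => g.map (f.map x), fun _ _ => (f.hom_le _ _).trans (g.hom_le _ _)⟩

theorem hom_ext {X Y : QCat Q} {f g : X ⟶ Y}
    (h : ∀ (q : Q) (x : X.fib q), QFunctor.map f x = QFunctor.map g x) : f = g := by
  apply QFunctor.ext
  funext q x
  exact h q x

/-- The order of `Q`-functors: `f ≤ g` iff `1 ≤ b(f x, g x)` for all `x`. -/
instance (X Y : QCat Q) : LE (X ⟶ Y) :=
  ⟨fun f g => ∀ (q : Q) (x : X.fib q), 𝟙 q ≤ Y.hom (QFunctor.map f x) (QFunctor.map g x)⟩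

/-- `f` is fully faithful: `a(x, x') = b(f x, f x')`. -/
def FullyFaithful {X Y : QCat Q} (f : X ⟶ Y) : Prop :=
  ∀ (p q : Q) (x : X.fib p) (x' : X.fib q),
    X.hom x x' = Y.hom (QFunctor.map f x) (QFunctor.map f x')

/-- `f` is injective on objects. -/
def ObjInjective {X Y : QCat Q} (f : X ⟶ Y) : Prop :=
  ∀ (q : Q) (x x' : X.fib q), QFunctor.map f x = QFunctor.map f x' → x = x'

theorem QCat.id_comp_le (X : QCat Q) {p q : Q} (x : X.fib p) (f : p ⟶ q) :
    f ≤ X.hom x x ≫ f := by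
  simpa using comp_mono (X.id_le x) (le_refl f)

theorem QCat.comp_id_le (X : QCat Q) {p q : Q} (x : X.fib q) (f : p ⟶ q) :
    f ≤ f ≫ X.hom x x := by
  simpa using comp_mono (le_refl f) (X.id_le x)

/-! ### `Q`-distributors -/

/-- A `Q`-distributor `φ : X ⇸ Y`: a family `φ(x, y) : |x| → |y|` with `b ∘ φ ∘ a ≤ φ`
(the inequality is spelled out elementwise). -/
@[ext]
structure QDist (X Y : QCat Q) where
  val : ∀ {p q : Q}, X.fib p → Y.fib q → (p ⟶ q)
  compat : ∀ {p p' q q' : Q} (x : X.fib p) (x' : X.fib p') (y' : Y.fib q') (y : Y.fib q),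
    X.hom x x' ≫ val x' y' ≫ Y.hom y' y ≤ val x y

theorem QDist.ext' {X Y : QCat Q} {φ ψ : QDist X Y}
    (h : ∀ (p q : Q) (x : X.fib p) (y : Y.fib q), φ.val x y = ψ.val x y) : φ = ψ := by
  apply QDist.ext
  funext p q x y
  exact h p q x y

instance (X Y : QCat Q) : LE (QDist X Y) :=
  ⟨fun φ ψ => ∀ (p q : Q) (x : X.fib p) (y : Y.fib q), φ.val x y ≤ ψ.val x y⟩

theorem QDist.left_le {X Y : QCat Q} (φ : QDist X Y) {p p' q : Q} (x : X.fib p) (x' : X.fib p')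
    (y : Y.fib q) : X.hom x x' ≫ φ.val x' y ≤ φ.val x y := by
  refine le_trans ?_ (φ.compat x x' y y)
  exact comp_mono le_rfl (Y.comp_id_le y _)

theorem QDist.right_le {X Y : QCat Q} (φ : QDist X Y) {p q q' : Q} (x : X.fib p) (y' : Y.fib q')
    (y : Y.fib q) : φ.val x y' ≫ Y.hom y' y ≤ φ.val x y := by
  refine le_trans ?_ (φ.compat x x y' y)
  exact X.id_comp_le x _

/-- The identity distributor on `X`, i.e. the hom of `X`. -/
def QDist.id (X : QCat Q) : QDist X X where
  val x y := X.hom x y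
  compat x x' y' y := (comp_mono le_rfl (X.comp_le x' y' y)).trans (X.comp_le x x' y)

/-- The composite of `φ : X ⇸ Y` followed by `ψ : Y ⇸ Z`, i.e. `ψ ∘ φ`. -/
def QDist.comp {X Y Z : QCat Q} (φ : QDist X Y) (ψ : QDist Y Z) : QDist X Z where
  val x z := ⨆ (q : Q) (y : Y.fib q), φ.val x y ≫ ψ.val y z
  compat x x' z' z := by
    simp only [iSup_comp, comp_iSup]
    refine iSup₂_le fun q y => le_iSup₂_of_le q y ?_
    have := comp_mono (φ.left_le x x' y) (ψ.right_le y z' z)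
    simpa only [Category.assoc] using this

/-- The graph `f_* = b ∘ f_∘` of a `Q`-functor, `f_*(x, y) = b(f x, y)`. -/
def lowerStar {X Y : QCat Q} (f : X ⟶ Y) : QDist X Y where
  val x y := Y.hom (QFunctor.map f x) y
  compat x x' y' y := by
    refine (comp_mono (QFunctor.hom_le f x x') (Y.comp_le _ y' y)).trans (Y.comp_le _ _ _)

/-- The cograph `f^* = f^∘ ∘ b` of a `Q`-functor, `f^*(y, x) = b(y, f x)`. -/
def upperStar {X Y : QCat Q} (f : X ⟶ Y) : QDist Y X where
  val y x := Y.hom y (QFunctor.map f x)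
  compat y y' x' x := by
    refine (comp_mono le_rfl (comp_mono le_rfl (QFunctor.hom_le f x' x))).trans ?_
    exact (comp_mono le_rfl (Y.comp_le _ _ _)).trans (Y.comp_le _ _ _)

/-! ### Presheaves and copresheaves -/

/-- A presheaf on `X` of type `s`, i.e. a distributor from `X` to the one-object `Q`-category of type
`s` with hom `1_s`. -/
@[ext]
structure Presheaf (X : QCat Q) (s : Q) where
  val : ∀ {q : Q}, X.fib q → (q ⟶ s)
  compat : ∀ {p q : Q} (x : X.fib p) (x' : X.fib q), X.hom x x' ≫ val x' ≤ val x

/-- A copresheaf on `X` of type `s`, i.e. a distributor from the one-object `Q`-category of type `s`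
with hom `1_s` to `X`. -/
@[ext]
structure Copresheaf (X : QCat Q) (s : Q) where
  val : ∀ {q : Q}, X.fib q → (s ⟶ q)
  compat : ∀ {p q : Q} (x : X.fib p) (x' : X.fib q), val x ≫ X.hom x x' ≤ val x'

theorem Presheaf.ext' {X : QCat Q} {s : Q} {σ τ : Presheaf X s}
    (h : ∀ (q : Q) (x : X.fib q), σ.val x = τ.val x) : σ = τ := by
  apply Presheaf.ext
  funext q x
  exact h q x

theorem Copresheaf.ext' {X : QCat Q} {s : Q} {σ τ : Copresheaf X s}
    (h : ∀ (q : Q) (x : X.fib q), σ.val x = τ.val x) : σ = τ := by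
  apply Copresheaf.ext
  funext q x
  exact h q x

/-- `τ ↙ σ` for presheaves, computed pointwise. -/
def Presheaf.hom {X : QCat Q} {s t : Q} (σ : Presheaf X s) (τ : Presheaf X t) : s ⟶ t :=
  ⨅ (q : Q) (x : X.fib q), lres (τ.val x) (σ.val x)

/-- `τ ↘ σ` for copresheaves, computed pointwise. -/
def Copresheaf.hom {X : QCat Q} {s t : Q} (σ : Copresheaf X s) (τ : Copresheaf X t) : s ⟶ t :=
  ⨅ (q : Q) (x : X.fib q), rres (τ.val x) (σ.val x)

theorem Presheaf.le_hom {X : QCat Q} {s t : Q} {σ : Presheaf X s} {τ : Presheaf X t} {u : s ⟶ t} :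
    u ≤ σ.hom τ ↔ ∀ (q : Q) (x : X.fib q), σ.val x ≫ u ≤ τ.val x := by
  simp only [Presheaf.hom, le_iInf_iff, le_lres]

theorem Copresheaf.le_hom {X : QCat Q} {s t : Q} {σ : Copresheaf X s} {τ : Copresheaf X t}
    {u : s ⟶ t} : u ≤ σ.hom τ ↔ ∀ (q : Q) (x : X.fib q), u ≫ τ.val x ≤ σ.val x := by
  simp only [Copresheaf.hom, le_iInf_iff, le_rres]

theorem Presheaf.val_comp_hom {X : QCat Q} {s t q : Q} (σ : Presheaf X s) (τ : Presheaf X t)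
    (x : X.fib q) : σ.val x ≫ σ.hom τ ≤ τ.val x :=
  Presheaf.le_hom.1 le_rfl q x

theorem Copresheaf.hom_comp_val {X : QCat Q} {s t q : Q} (σ : Copresheaf X s) (τ : Copresheaf X t)
    (x : X.fib q) : σ.hom τ ≫ τ.val x ≤ σ.val x :=
  Copresheaf.le_hom.1 le_rfl q x

/-- The `Q`-category `𝒫 X` of presheaves on `X`. -/
def PObj (X : QCat Q) : QCat Q where
  fib s := Presheaf X s
  hom σ τ := σ.hom τ
  id_le σ := Presheaf.le_hom.2 fun _ x => by simp
  comp_le σ τ ρ := Presheaf.le_hom.2 fun q x => by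
    rw [← Category.assoc]
    exact (comp_mono (σ.val_comp_hom τ x) le_rfl).trans (τ.val_comp_hom ρ x)

/-- The `Q`-category `𝒫† X` of copresheaves on `X`. -/
def PdObj (X : QCat Q) : QCat Q where
  fib s := Copresheaf X s
  hom σ τ := σ.hom τ
  id_le σ := Copresheaf.le_hom.2 fun _ x => by simp
  comp_le σ τ ρ := Copresheaf.le_hom.2 fun q x => by
    rw [Category.assoc]
    exact (comp_mono le_rfl (τ.hom_comp_val ρ x)).trans (σ.hom_comp_val τ x)

/-- `φ^⊙ τ = τ ∘ φ` for a distributor `φ : X ⇸ Y` and a presheaf `τ` on `Y`. -/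
def odotVal {X Y : QCat Q} (φ : QDist X Y) {s : Q} (τ : Presheaf Y s) : Presheaf X s where
  val x := ⨆ (q : Q) (y : Y.fib q), φ.val x y ≫ τ.val y
  compat x x' := by
    simp only [comp_iSup, ← Category.assoc]
    exact iSup₂_mono fun q y => comp_mono (φ.left_le x x' y) le_rfl

/-- `φ^⊕ σ = φ ∘ σ` for a distributor `φ : X ⇸ Y` and a copresheaf `σ` on `X`. -/
def oplusVal {X Y : QCat Q} (φ : QDist X Y) {s : Q} (σ : Copresheaf X s) : Copresheaf Y s where
  val y := ⨆ (q : Q) (x : X.fib q), σ.val x ≫ φ.val x y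
  compat y y' := by
    simp only [iSup_comp, Category.assoc]
    exact iSup₂_mono fun q x => comp_mono le_rfl (φ.right_le x y y')

/-- The `Q`-functor `φ^⊙ : 𝒫 Y → 𝒫 X`. -/
def odot {X Y : QCat Q} (φ : QDist X Y) : PObj Y ⟶ PObj X where
  map τ := odotVal φ τ
  hom_le σ τ := Presheaf.le_hom.2 fun q x => by
    simp only [odotVal, iSup_comp, Category.assoc]
    exact iSup₂_mono fun q y => comp_mono le_rfl (Presheaf.val_comp_hom σ τ y)

/-- The `Q`-functor `φ^⊕ : 𝒫† X → 𝒫† Y`. -/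
def oplus {X Y : QCat Q} (φ : QDist X Y) : PdObj X ⟶ PdObj Y where
  map σ := oplusVal φ σ
  hom_le σ τ := Copresheaf.le_hom.2 fun q y => by
    simp only [oplusVal, comp_iSup, ← Category.assoc]
    exact iSup₂_mono fun q x => comp_mono (Copresheaf.hom_comp_val σ τ x) le_rfl

/-- `σ ∘ f^*` at `y` is computed from the representables. -/
theorem odot_upper_val {X Y : QCat Q} (f : X ⟶ Y) {s q : Q} (σ : Presheaf X s) (y : Y.fib q) :
    (odotVal (upperStar f) σ).val y
      = ⨆ (p : Q) (x : X.fib p), Y.hom y (QFunctor.map f x) ≫ σ.val x := rfl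

theorem odot_lower_val {X Y : QCat Q} (f : X ⟶ Y) {s q : Q} (τ : Presheaf Y s) (x : X.fib q) :
    (odotVal (lowerStar f) τ).val x = τ.val (QFunctor.map f x) := by
  refine le_antisymm (iSup₂_le fun p y => τ.compat _ _) ?_
  exact le_iSup₂_of_le q (QFunctor.map f x) (Y.id_comp_le _ _)

theorem oplus_upper_val {X Y : QCat Q} (f : X ⟶ Y) {s q : Q} (τ : Copresheaf Y s) (x : X.fib q) :
    (oplusVal (upperStar f) τ).val x = τ.val (QFunctor.map f x) := by
  refine le_antisymm (iSup₂_le fun p y => τ.compat _ _) ?_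
  exact le_iSup₂_of_le q (QFunctor.map f x) (Y.comp_id_le _ _)

theorem odot_id {X : QCat Q} {s : Q} (σ : Presheaf X s) : odotVal (upperStar (𝟙 X)) σ = σ :=
  Presheaf.ext' fun q x => odot_lower_val (𝟙 X) σ x

theorem oplus_id {X : QCat Q} {s : Q} (σ : Copresheaf X s) : oplusVal (lowerStar (𝟙 X)) σ = σ :=
  Copresheaf.ext' fun q x => oplus_upper_val (𝟙 X) σ x

theorem odot_comp {X Y Z : QCat Q} (f : X ⟶ Y) (g : Y ⟶ Z) {s : Q} (σ : Presheaf X s) :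
    odotVal (upperStar (f ≫ g)) σ = odotVal (upperStar g) (odotVal (upperStar f) σ) := by
  refine Presheaf.ext' fun q z => le_antisymm ?_ ?_
  · refine iSup₂_le fun p x => le_iSup₂_of_le p (QFunctor.map f x) ?_
    refine comp_mono le_rfl (le_iSup₂_of_le p x ?_)
    exact Y.id_comp_le _ _
  · refine iSup₂_le fun p y => ?_
    simp only [odotVal, comp_iSup, ← Category.assoc]
    refine iSup₂_mono fun r x => comp_mono ?_ le_rfl
    exact (comp_mono le_rfl (QFunctor.hom_le g _ _)).trans (Z.comp_le _ _ _)

theorem oplus_comp {X Y Z : QCat Q} (f : X ⟶ Y) (g : Y ⟶ Z) {s : Q} (σ : Copresheaf X s) :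
    oplusVal (lowerStar (f ≫ g)) σ = oplusVal (lowerStar g) (oplusVal (lowerStar f) σ) := by
  refine Copresheaf.ext' fun q z => le_antisymm ?_ ?_
  · refine iSup₂_le fun p x => le_iSup₂_of_le p (QFunctor.map f x) ?_
    refine comp_mono (le_iSup₂_of_le p x ?_) le_rfl
    exact Y.comp_id_le _ _
  · refine iSup₂_le fun p y => ?_
    simp only [oplusVal, iSup_comp, Category.assoc]
    refine iSup₂_mono fun r x => comp_mono le_rfl ?_
    exact (comp_mono (QFunctor.hom_le g _ _) le_rfl).trans (Z.comp_le _ _ _)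

variable (Q) in
/-- The presheaf functor `𝒫`, with `𝒫 f = f_! = (f^*)^⊙`. -/
def PFun : QCat Q ⥤ QCat Q where
  obj X := PObj X
  map f := odot (upperStar f)
  map_id _ := hom_ext fun _ σ => odot_id σ
  map_comp f g := hom_ext fun _ σ => odot_comp f g σ

variable (Q) in
/-- The copresheaf functor `𝒫†`, with `𝒫† f = (f_*)^⊕`. -/
def PdFun : QCat Q ⥤ QCat Q where
  obj X := PdObj X
  map f := oplus (lowerStar f)
  map_id _ := hom_ext fun _ σ => oplus_id σ
  map_comp f g := hom_ext fun _ σ => oplus_comp f g σ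

/-- For a distributor `φ : X ⇸ Y`, the `Q`-functor `Y → 𝒫 X`, `y ↦ φ(-, y)`. -/
def transposeL {X Y : QCat Q} (φ : QDist X Y) : Y ⟶ PObj X where
  map y := ⟨fun x => φ.val x y, fun x x' => φ.left_le x x' y⟩
  hom_le y y' := Presheaf.le_hom.2 fun _ x => φ.right_le x y y'

/-- For a distributor `φ : X ⇸ Y`, the `Q`-functor `X → 𝒫† Y`, `x ↦ φ(x, -)`. -/
def transposeR {X Y : QCat Q} (φ : QDist X Y) : X ⟶ PdObj Y where
  map x := ⟨fun y => φ.val x y, fun y y' => φ.right_le x y y'⟩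
  hom_le x x' := Copresheaf.le_hom.2 fun _ y => φ.left_le x x' y

/-- The Yoneda functor `X → 𝒫 X`, `x ↦ a(-, x)`. -/
def yoneda (X : QCat Q) : X ⟶ PObj X := transposeL (QDist.id X)

/-- The co-Yoneda functor `X → 𝒫† X`, `x ↦ a(x, -)`. -/
def coyoneda (X : QCat Q) : X ⟶ PdObj X := transposeR (QDist.id X)

/-- The Yoneda lemma. -/
theorem yoneda_hom {X : QCat Q} {p s : Q} (x : X.fib p) (σ : Presheaf X s) :
    (PObj X).hom (QFunctor.map (yoneda X) x) σ = σ.val x := by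
  refine le_antisymm ?_ (Presheaf.le_hom.2 fun q z => σ.compat z x)
  refine (X.id_comp_le x _).trans ?_
  exact Presheaf.val_comp_hom (QFunctor.map (yoneda X) x : Presheaf X p) σ x

/-- The co-Yoneda lemma. -/
theorem coyoneda_hom {X : QCat Q} {p s : Q} (σ : Copresheaf X s) (x : X.fib p) :
    (PdObj X).hom σ (QFunctor.map (coyoneda X) x) = σ.val x := by
  refine le_antisymm ?_ (Copresheaf.le_hom.2 fun q z => σ.compat x z)
  refine (X.comp_id_le x _).trans ?_
  exact Copresheaf.hom_comp_val σ (QFunctor.map (coyoneda X) x : Copresheaf X p) x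

/-! ### 2-monads -/

/-- The structure of a 2-monad on an endofunctor `T` of the (locally preordered) 2-category of
`Q`-categories: `T` is a 2-functor, and it carries a unit and a multiplication satisfying the monad
laws. (2-naturality is the same as naturality since the hom-categories are preorders.) -/
structure TwoMonad (T : QCat Q ⥤ QCat Q) where
  map_mono : ∀ {X Y : QCat Q} (f g : X ⟶ Y), f ≤ g → T.map f ≤ T.map g
  unit : 𝟭 (QCat Q) ⟶ T
  mult : T ⋙ T ⟶ T
  left_unit : ∀ X : QCat Q, unit.app (T.obj X) ≫ mult.app X = 𝟙 (T.obj X)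
  right_unit : ∀ X : QCat Q, T.map (unit.app X) ≫ mult.app X = 𝟙 (T.obj X)
  assoc : ∀ X : QCat Q, T.map (mult.app X) ≫ mult.app X = mult.app (T.obj X) ≫ mult.app X

/-- The underlying monad of a 2-monad. -/
def TwoMonad.toMonad {T : QCat Q ⥤ QCat Q} (M : TwoMonad T) : Monad (QCat Q) where
  toFunctor := T
  η := M.unit
  μ := M.mult
  assoc := M.assoc
  left_unit := M.left_unit
  right_unit := M.right_unit

/-- `ι` exhibits `M` as a sub-2-monad of `N`: it is a morphism of monads all of whose components are
fully faithful and injective on objects. -/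
structure IsSubTwoMonad {S T : QCat Q ⥤ QCat Q} (M : TwoMonad S) (N : TwoMonad T) (ι : S ⟶ T) :
    Prop where
  monadHom : ∃ j : M.toMonad ⟶ N.toMonad, j.toNatTrans = ι
  fullyFaithful : ∀ X : QCat Q, FullyFaithful (ι.app X)
  injective : ∀ X : QCat Q, ObjInjective (ι.app X)

/-! ### The double presheaf 2-monads -/

theorem PFun_mono {X Y : QCat Q} (f g : X ⟶ Y) (h : f ≤ g) : (PFun Q).map f ≤ (PFun Q).map g := by
  intro s σ
  refine Presheaf.le_hom.2 fun q y => ?_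
  rw [Category.comp_id]
  refine iSup₂_mono fun p x => comp_mono ?_ le_rfl
  refine le_trans ?_ (Y.comp_le y (QFunctor.map f x) (QFunctor.map g x))
  have := comp_mono (le_refl (Y.hom y (QFunctor.map f x))) (h p x)
  rwa [Category.comp_id] at this

theorem PdFun_mono {X Y : QCat Q} (f g : X ⟶ Y) (h : f ≤ g) :
    (PdFun Q).map f ≤ (PdFun Q).map g := by
  intro s σ
  refine Copresheaf.le_hom.2 fun q y => ?_
  rw [Category.id_comp]
  refine iSup₂_mono fun p x => comp_mono le_rfl ?_
  refine le_trans ?_ (Y.comp_le (QFunctor.map f x) (QFunctor.map g x) y)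
  have := comp_mono (h p x) (le_refl (Y.hom (QFunctor.map g x) y))
  rwa [Category.id_comp] at this

theorem PFun_map_yoneda {X Y : QCat Q} (f : X ⟶ Y) {p : Q} (x : X.fib p) :
    QFunctor.map ((PFun Q).map f) (QFunctor.map (yoneda X) x)
      = QFunctor.map (yoneda Y) (QFunctor.map f x) := by
  refine Presheaf.ext' fun q y => le_antisymm (iSup₂_le fun r z => ?_) ?_
  · exact (comp_mono le_rfl (QFunctor.hom_le f z x)).trans (Y.comp_le _ _ _)
  · exact le_iSup₂_of_le p x (X.comp_id_le x _)

theorem PdFun_map_coyoneda {X Y : QCat Q} (f : X ⟶ Y) {p : Q} (x : X.fib p) :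
    QFunctor.map ((PdFun Q).map f) (QFunctor.map (coyoneda X) x)
      = QFunctor.map (coyoneda Y) (QFunctor.map f x) := by
  refine Copresheaf.ext' fun q y => le_antisymm (iSup₂_le fun r z => ?_) ?_
  · exact (comp_mono (QFunctor.hom_le f x z) le_rfl).trans (Y.comp_le _ _ _)
  · exact le_iSup₂_of_le p x (X.id_comp_le x _)

/-- `(𝒫𝒫† f Σ)(τ) = Σ(f^* ∘ τ)`. -/
theorem PPd_map_val {X Y : QCat Q} (f : X ⟶ Y) {s t : Q} (S : Presheaf (PdObj X) s)
    (τ : Copresheaf Y t) :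
    (odotVal (upperStar (oplus (lowerStar f))) S).val τ = S.val (oplusVal (upperStar f) τ) := by
  refine le_antisymm (iSup₂_le fun r ρ => ?_) ?_
  · refine le_trans (comp_mono ?_ le_rfl) (S.compat _ ρ)
    refine Copresheaf.le_hom.2 fun q x => ?_
    rw [oplus_upper_val]
    refine le_trans (comp_mono le_rfl ?_)
      (Copresheaf.hom_comp_val τ (oplusVal (lowerStar f) ρ) (QFunctor.map f x))
    exact le_iSup₂_of_le q x (Y.comp_id_le _ _)
  · refine le_iSup₂_of_le t (oplusVal (upperStar f) τ) ?_
    refine le_trans ?_ (comp_mono (f := 𝟙 t) ?_ le_rfl)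
    · simp
    · refine Copresheaf.le_hom.2 fun q y => ?_
      rw [Category.id_comp]
      refine iSup₂_le fun r x => ?_
      rw [oplus_upper_val]
      exact τ.compat _ _

/-- `(𝒫†𝒫 f Σ)(τ) = Σ(τ ∘ f_*)`. -/
theorem PdP_map_val {X Y : QCat Q} (f : X ⟶ Y) {s t : Q} (S : Copresheaf (PObj X) s)
    (τ : Presheaf Y t) :
    (oplusVal (lowerStar (odot (upperStar f))) S).val τ = S.val (odotVal (lowerStar f) τ) := by
  refine le_antisymm (iSup₂_le fun r ρ => ?_) ?_
  · refine le_trans (comp_mono le_rfl ?_) (S.compat ρ _)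
    refine Presheaf.le_hom.2 fun q x => ?_
    rw [odot_lower_val]
    refine le_trans (comp_mono ?_ le_rfl)
      (Presheaf.val_comp_hom (odotVal (upperStar f) ρ) τ (QFunctor.map f x))
    exact le_iSup₂_of_le q x (Y.id_comp_le _ _)
  · refine le_iSup₂_of_le t (odotVal (lowerStar f) τ) ?_
    refine le_trans ?_ (comp_mono (g := 𝟙 t) le_rfl ?_)
    · simp
    · refine Presheaf.le_hom.2 fun q y => ?_
      rw [Category.comp_id]
      refine iSup₂_le fun r x => ?_
      rw [odot_lower_val]
      exact τ.compat _ _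

/-- `𝔶_X = y_{𝒫†X} · y†_X : X → 𝒫𝒫†X`. -/
def PPdUnit (X : QCat Q) : X ⟶ PObj (PdObj X) := coyoneda X ≫ yoneda (PdObj X)

/-- `𝔰_X = ((y†_{𝒫𝒫†X} · y_{𝒫†X})_*)^⊙ : 𝒫𝒫†𝒫𝒫†X → 𝒫𝒫†X`. -/
def PPdMult (X : QCat Q) : PObj (PdObj (PObj (PdObj X))) ⟶ PObj (PdObj X) :=
  odot (lowerStar (yoneda (PdObj X) ≫ coyoneda (PObj (PdObj X))))

/-- `𝔶†_X = y†_{𝒫X} · y_X : X → 𝒫†𝒫X`. -/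
def PdPUnit (X : QCat Q) : X ⟶ PdObj (PObj X) := yoneda X ≫ coyoneda (PObj X)

/-- `𝔰†_X = ((y_{𝒫†𝒫X} · y†_{𝒫X})^*)^⊕ : 𝒫†𝒫𝒫†𝒫X → 𝒫†𝒫X`. -/
def PdPMult (X : QCat Q) : PdObj (PObj (PdObj (PObj X))) ⟶ PdObj (PObj X) :=
  oplus (upperStar (coyoneda (PObj X) ≫ yoneda (PdObj (PObj X))))

/-- Evaluation at `τ`, as a copresheaf on `𝒫𝒫†X`. -/
def evL {X : QCat Q} {t : Q} (τ : Copresheaf X t) : Copresheaf (PObj (PdObj X)) t :=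
  QFunctor.map (yoneda (PdObj X) ≫ coyoneda (PObj (PdObj X))) τ

/-- Evaluation at `τ`, as a presheaf on `𝒫†𝒫X`. -/
def evR {X : QCat Q} {t : Q} (τ : Presheaf X t) : Presheaf (PdObj (PObj X)) t :=
  QFunctor.map (coyoneda (PObj X) ≫ yoneda (PdObj (PObj X))) τ

theorem evL_val {X : QCat Q} {s t : Q} (τ : Copresheaf X t) (S : Presheaf (PdObj X) s) :
    (evL τ).val S = S.val τ :=
  yoneda_hom (X := PdObj X) τ S

theorem evR_val {X : QCat Q} {s t : Q} (τ : Presheaf X t) (S : Copresheaf (PObj X) s) :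
    (evR τ).val S = S.val τ :=
  coyoneda_hom (X := PObj X) S τ

theorem PPdMult_val {X : QCat Q} {s t : Q} (W : Presheaf (PdObj (PObj (PdObj X))) s)
    (τ : Copresheaf X t) :
    (QFunctor.map (PPdMult X) W : Presheaf (PdObj X) s).val τ = W.val (evL τ) :=
  odot_lower_val (yoneda (PdObj X) ≫ coyoneda (PObj (PdObj X))) W τ

theorem PdPMult_val {X : QCat Q} {s t : Q} (W : Copresheaf (PObj (PdObj (PObj X))) s)
    (τ : Presheaf X t) :
    (QFunctor.map (PdPMult X) W : Copresheaf (PObj X) s).val τ = W.val (evR τ) :=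
  oplus_upper_val (coyoneda (PObj X) ≫ yoneda (PdObj (PObj X))) W τ

variable (Q) in
/-- The double presheaf 2-monad `(𝒫𝒫†, 𝔰, 𝔶)`. -/
def doublePresheaf : TwoMonad (PdFun Q ⋙ PFun Q) where
  map_mono f g h := PFun_mono _ _ (PdFun_mono f g h)
  unit :=
    { app := fun X => PPdUnit X
      naturality := fun X Y f => hom_ext fun q x => by
        refine Eq.symm ((PFun_map_yoneda _ _).trans ?_)
        exact congrArg (QFunctor.map (yoneda (PdObj Y))) (PdFun_map_coyoneda f x) }
  mult :=
    { app := fun X => PPdMult X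
      naturality := fun X Y f => hom_ext fun s W => Presheaf.ext' fun t τ => by
        refine (PPdMult_val _ τ).trans ?_
        refine (PPd_map_val _ W (evL τ)).trans ?_
        refine Eq.trans ?_ (PPd_map_val f _ τ).symm
        refine Eq.trans (congrArg W.val ?_) (PPdMult_val W _).symm
        refine Copresheaf.ext' fun q S => ?_
        refine (oplus_upper_val _ _ S).trans ?_
        refine (evL_val τ _).trans ?_
        refine Eq.trans (PPd_map_val f S τ) (evL_val _ S).symm }
  left_unit X := hom_ext fun s S => Presheaf.ext' fun t τ => by
    refine (PPdMult_val _ τ).trans ?_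
    refine (coyoneda_hom (X := PObj (PdObj X)) (evL τ) S).trans (evL_val τ S)
  right_unit X := hom_ext fun s S => Presheaf.ext' fun t τ => by
    refine (PPdMult_val _ τ).trans ?_
    refine (PPd_map_val _ S (evL τ)).trans (congrArg S.val ?_)
    refine Copresheaf.ext' fun q x => ?_
    refine (oplus_upper_val _ _ x).trans ((evL_val τ _).trans ?_)
    exact coyoneda_hom τ x
  assoc X := hom_ext fun s W => Presheaf.ext' fun t τ => by
    refine (PPdMult_val _ τ).trans ?_
    refine (PPd_map_val _ W (evL τ)).trans ?_
    refine Eq.symm ((PPdMult_val _ τ).trans ((PPdMult_val W (evL τ)).trans (congrArg W.val ?_)))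
    refine Copresheaf.ext' fun q S => Eq.symm ?_
    refine (oplus_upper_val _ _ S).trans ((evL_val τ _).trans ?_)
    exact (PPdMult_val S τ).trans (evL_val (evL τ) S).symm

variable (Q) in
/-- The double copresheaf 2-monad `(𝒫†𝒫, 𝔰†, 𝔶†)`. -/
def doubleCopresheaf : TwoMonad (PFun Q ⋙ PdFun Q) where
  map_mono f g h := PdFun_mono _ _ (PFun_mono f g h)
  unit :=
    { app := fun X => PdPUnit X
      naturality := fun X Y f => hom_ext fun q x => by
        refine Eq.symm ((PdFun_map_coyoneda _ _).trans ?_)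
        exact congrArg (QFunctor.map (coyoneda (PObj Y))) (PFun_map_yoneda f x) }
  mult :=
    { app := fun X => PdPMult X
      naturality := fun X Y f => hom_ext fun s W => Copresheaf.ext' fun t τ => by
        refine (PdPMult_val _ τ).trans ?_
        refine (PdP_map_val _ W (evR τ)).trans ?_
        refine Eq.trans ?_ (PdP_map_val f _ τ).symm
        refine Eq.trans (congrArg W.val ?_) (PdPMult_val W _).symm
        refine Presheaf.ext' fun q S => ?_
        refine (odot_lower_val _ _ S).trans ?_
        refine (evR_val τ _).trans ?_
        refine Eq.trans (PdP_map_val f S τ) (evR_val _ S).symm }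
  left_unit X := hom_ext fun s S => Copresheaf.ext' fun t τ => by
    refine (PdPMult_val _ τ).trans ?_
    refine (yoneda_hom (X := PdObj (PObj X)) S (evR τ)).trans (evR_val τ S)
  right_unit X := hom_ext fun s S => Copresheaf.ext' fun t τ => by
    refine (PdPMult_val _ τ).trans ?_
    refine (PdP_map_val _ S (evR τ)).trans (congrArg S.val ?_)
    refine Presheaf.ext' fun q x => ?_
    refine (odot_lower_val _ _ x).trans ((evR_val τ _).trans ?_)
    exact yoneda_hom x τ
  assoc X := hom_ext fun s W => Copresheaf.ext' fun t τ => by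
    refine (PdPMult_val _ τ).trans ?_
    refine (PdP_map_val _ W (evR τ)).trans ?_
    refine Eq.symm ((PdPMult_val _ τ).trans ((PdPMult_val W (evR τ)).trans (congrArg W.val ?_)))
    refine Presheaf.ext' fun q S => Eq.symm ?_
    refine (odot_lower_val _ _ S).trans ((evR_val τ _).trans ?_)
    exact (PdPMult_val S τ).trans (evR_val (evR τ) S).symm

/-! ### Conical presheaves and copresheaves -/

/-- `σ` is conical: `σ = ⋁_{x ∈ A} a(-, x)` for some set `A` of objects of type `|σ|`. -/
def Presheaf.IsConical {X : QCat Q} {s : Q} (σ : Presheaf X s) : Prop :=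
  ∃ A : Set (X.fib s), ∀ (q : Q) (z : X.fib q), σ.val z = ⨆ x ∈ A, X.hom z x

/-- `τ` is conical: `τ = ⋁_{x ∈ A} a(x, -)` for some set `A` of objects of type `|τ|`. -/
def Copresheaf.IsConical {X : QCat Q} {s : Q} (τ : Copresheaf X s) : Prop :=
  ∃ A : Set (X.fib s), ∀ (q : Q) (z : X.fib q), τ.val z = ⨆ x ∈ A, X.hom x z

theorem Presheaf.IsConical.map {X Y : QCat Q} (f : X ⟶ Y) {s : Q} {σ : Presheaf X s}
    (h : σ.IsConical) : (odotVal (upperStar f) σ).IsConical := by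
  obtain ⟨A, hA⟩ := h
  refine ⟨(fun x => QFunctor.map f x) '' A, fun q y => ?_⟩
  rw [iSup_image]
  refine le_antisymm (iSup₂_le fun p z => ?_) (iSup₂_le fun x hx => ?_)
  · rw [hA, comp_iSup]
    refine iSup_mono fun x => ?_
    rw [comp_iSup]
    refine iSup_mono fun _ => ?_
    exact (comp_mono le_rfl (QFunctor.hom_le f z x)).trans (Y.comp_le _ _ _)
  · refine le_iSup₂_of_le s x ?_
    refine le_trans (X.comp_id_le x _) (comp_mono le_rfl ?_)
    rw [hA]
    exact le_iSup₂_of_le x hx le_rfl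

theorem Copresheaf.IsConical.map {X Y : QCat Q} (f : X ⟶ Y) {s : Q} {τ : Copresheaf X s}
    (h : τ.IsConical) : (oplusVal (lowerStar f) τ).IsConical := by
  obtain ⟨A, hA⟩ := h
  refine ⟨(fun x => QFunctor.map f x) '' A, fun q y => ?_⟩
  rw [iSup_image]
  refine le_antisymm (iSup₂_le fun p z => ?_) (iSup₂_le fun x hx => ?_)
  · rw [hA, iSup_comp]
    refine iSup_mono fun x => ?_
    rw [iSup_comp]
    refine iSup_mono fun _ => ?_
    exact (comp_mono (QFunctor.hom_le f x z) le_rfl).trans (Y.comp_le _ _ _)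
  · refine le_iSup₂_of_le s x ?_
    refine le_trans (X.id_comp_le x _) (comp_mono ?_ le_rfl)
    rw [hA]
    exact le_iSup₂_of_le x hx le_rfl

/-- The `Q`-category `ℋ X` of conical presheaves on `X`, with the structure inherited from `𝒫 X`. -/
def HObj (X : QCat Q) : QCat Q where
  fib s := {σ : Presheaf X s // σ.IsConical}
  hom σ τ := (PObj X).hom σ.1 τ.1
  id_le σ := (PObj X).id_le σ.1
  comp_le σ τ ρ := (PObj X).comp_le σ.1 τ.1 ρ.1

/-- The `Q`-category `ℋ† X` of conical copresheaves on `X`, with the structure inherited from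
`𝒫† X`. -/
def HdObj (X : QCat Q) : QCat Q where
  fib s := {σ : Copresheaf X s // σ.IsConical}
  hom σ τ := (PdObj X).hom σ.1 τ.1
  id_le σ := (PdObj X).id_le σ.1
  comp_le σ τ ρ := (PdObj X).comp_le σ.1 τ.1 ρ.1

variable (Q) in
/-- The Hausdorff functor `ℋ`: on `Q`-functors it restricts `𝒫`. -/
def HFun : QCat Q ⥤ QCat Q where
  obj X := HObj X
  map f :=
    { map := fun σ => ⟨QFunctor.map ((PFun Q).map f) σ.1, σ.2.map f⟩
      hom_le := fun σ τ => QFunctor.hom_le ((PFun Q).map f) σ.1 τ.1 }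
  map_id _ := hom_ext fun _ σ => Subtype.ext (odot_id σ.1)
  map_comp f g := hom_ext fun _ σ => Subtype.ext (odot_comp f g σ.1)

variable (Q) in
/-- The co-Hausdorff functor `ℋ†`: on `Q`-functors it restricts `𝒫†`. -/
def HdFun : QCat Q ⥤ QCat Q where
  obj X := HdObj X
  map f :=
    { map := fun σ => ⟨QFunctor.map ((PdFun Q).map f) σ.1, σ.2.map f⟩
      hom_le := fun σ τ => QFunctor.hom_le ((PdFun Q).map f) σ.1 τ.1 }
  map_id _ := hom_ext fun _ σ => Subtype.ext (oplus_id σ.1)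
  map_comp f g := hom_ext fun _ σ => Subtype.ext (oplus_comp f g σ.1)

variable (Q) in
/-- The inclusion `ℋ → 𝒫`. -/
def inclH : HFun Q ⟶ PFun Q where
  app _ := ⟨fun σ => σ.1, fun _ _ => le_rfl⟩
  naturality _ _ _ := rfl

variable (Q) in
/-- The inclusion `ℋ† → 𝒫†`. -/
def inclHd : HdFun Q ⟶ PdFun Q where
  app _ := ⟨fun σ => σ.1, fun _ _ => le_rfl⟩
  naturality _ _ _ := rfl

/-- The Yoneda functor `X → ℋ X`. -/
def yonedaH (X : QCat Q) : X ⟶ HObj X where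
  map x := ⟨QFunctor.map (yoneda X) x, {x}, fun q z => by simp [yoneda, transposeL, QDist.id]⟩
  hom_le x y := QFunctor.hom_le (yoneda X) x y

/-- The co-Yoneda functor `X → ℋ† X`. -/
def coyonedaH (X : QCat Q) : X ⟶ HdObj X where
  map x := ⟨QFunctor.map (coyoneda X) x, {x}, fun q z => by simp [coyoneda, transposeR, QDist.id]⟩
  hom_le x y := QFunctor.hom_le (coyoneda X) x y

/-! ### Lax extensions to `Q`-distributors -/

/-- An assignment `φ ↦ E φ` of distributors `T X ⇸ T Y` to distributors `X ⇸ Y`. -/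
abbrev DistMap (T : QCat Q ⥤ QCat Q) : Type (u + 1) :=
  ∀ X Y : QCat Q, QDist X Y → QDist (T.obj X) (T.obj Y)

/-- `E` is a lax extension of `T`: a lax functor on `Q`-distributors which agrees with `T` on objects
and satisfies `(T f)_* ≤ E (f_*)` and `(T f)^* ≤ E (f^*)`. -/
structure IsLaxExtension (T : QCat Q ⥤ QCat Q) (E : DistMap T) : Prop where
  mono : ∀ {X Y : QCat Q} (φ ψ : QDist X Y), φ ≤ ψ → E X Y φ ≤ E X Y ψ
  id_le : ∀ X : QCat Q, QDist.id (T.obj X) ≤ E X X (QDist.id X)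
  comp_le : ∀ {X Y Z : QCat Q} (φ : QDist X Y) (ψ : QDist Y Z),
    (E X Y φ).comp (E Y Z ψ) ≤ E X Z (φ.comp ψ)
  lower_le : ∀ {X Y : QCat Q} (f : X ⟶ Y), lowerStar (T.map f) ≤ E X Y (lowerStar f)
  upper_le : ∀ {X Y : QCat Q} (f : X ⟶ Y), upperStar (T.map f) ≤ E Y X (upperStar f)

/-- The lax extension `E` of `T` is flat: `(T f)_* = E (f_*)` and `(T f)^* = E (f^*)`. -/
structure IsFlatLaxExtension (T : QCat Q ⥤ QCat Q) (E : DistMap T) : Prop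
    extends IsLaxExtension T E where
  lower_eq : ∀ {X Y : QCat Q} (f : X ⟶ Y), lowerStar (T.map f) = E X Y (lowerStar f)
  upper_eq : ∀ {X Y : QCat Q} (f : X ⟶ Y), upperStar (T.map f) = E Y X (upperStar f)

/-- `E` is a lax extension of the 2-monad `M = (T, m, e)`: a lax extension of `T` for which `m_*` and
`e_*` are oplax. -/
structure IsMonadLaxExtension {T : QCat Q ⥤ QCat Q} (M : TwoMonad T) (E : DistMap T) : Prop
    extends IsLaxExtension T E where
  mult_oplax : ∀ {X Y : QCat Q} (φ : QDist X Y),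
    (E (T.obj X) (T.obj Y) (E X Y φ)).comp (lowerStar (M.mult.app Y))
      ≤ (lowerStar (M.mult.app X)).comp (E X Y φ)
  unit_oplax : ∀ {X Y : QCat Q} (φ : QDist X Y),
    φ.comp (lowerStar (M.unit.app Y)) ≤ (lowerStar (M.unit.app X)).comp (E X Y φ)

/-- The minimal extension `T̄ φ = (T φ⃖)^* ∘ (T y_X)_*`, where `φ⃖ : Y → 𝒫 X` is the transpose of
`φ : X ⇸ Y`. -/
def barExt (T : QCat Q ⥤ QCat Q) : DistMap T := fun X _ φ =>
  (lowerStar (T.map (yoneda X))).comp (upperStar (T.map (transposeL φ)))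

end QEnr

open QEnr

namespace QEnr

variable {Q : Type u} [Quantaloid Q]

/-! ### Distributors and graphs of functors -/

/-! The statement splits into two independent halves. Extensions. Every distributor `φ` is the graph
of a Yoneda functor followed by the cograph of its transpose (`yoneda_comp_transposeL`). A lax
extension preserves composition with cographs (`IsLaxExtension.comp_upperStar`) because `f_*` and
`f^*` are adjoint, so a flat one has no freedom: it is `barExt` (`IsFlatLaxExtension.eq_barExt`).
Conversely `barExt T` is always lax for a 2-functor `T`, and flat once `T` keeps the Yoneda functors
fully faithful. Flatness of the outer functor alone makes `barExt` multiplicative (`barExt_comp`),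
and compatibility with a monad then follows from naturality of its unit and multiplication. Both
Hausdorff functors preserve full faithfulness, so all this applies to their composites. Monads. The
inclusion into the double (co)presheaf functor is fully faithful and injective, so the monad laws
are inherited once the unit and multiplication restrict (`exists_isSubTwoMonad`). The unit restricts
because representables are conical. The multiplication is the real point, and the only place where
complete distributivity enters. On conical data its value at `τ` is a join of meets of joins of
homs; distributing the inner meet over the inner join gives a join of meets, and each such meet is a
hom with the cone on a union of generating sets. Hence the result is again conical
(`exists_HHd_mult`, `exists_HdH_mult`). -/

theorem QDist.le_antisymm {X Y : QCat Q} {φ ψ : QDist X Y} (h : φ ≤ ψ) (h' : ψ ≤ φ) : φ = ψ :=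
  QDist.ext' fun p q x y => _root_.le_antisymm (h p q x y) (h' p q x y)

theorem QDist.le_trans {X Y : QCat Q} {φ ψ χ : QDist X Y} (h : φ ≤ ψ) (h' : ψ ≤ χ) : φ ≤ χ :=
  fun p q x y => _root_.le_trans (h p q x y) (h' p q x y)

theorem QDist.comp_mono {X Y Z : QCat Q} {φ φ' : QDist X Y} {ψ ψ' : QDist Y Z} (h : φ ≤ φ')
    (h' : ψ ≤ ψ') : φ.comp ψ ≤ φ'.comp ψ' :=
  fun _ _ x z => iSup₂_mono fun q y => QEnr.comp_mono (h _ q x y) (h' q _ y z)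

theorem QDist.le_refl {X Y : QCat Q} (φ : QDist X Y) : φ ≤ φ := fun _ _ _ _ => le_rfl

/-- The join is attained at the image of `z`. With this, composing with a cograph is mere
substitution, so values of `barExt` become single homs in `T (𝒫 X)`. -/
theorem comp_upperStar_val {X Y Z : QCat Q} (φ : QDist X Y) (f : Z ⟶ Y) {p q : Q} (x : X.fib p)
    (z : Z.fib q) : (φ.comp (upperStar f)).val x z = φ.val x (QFunctor.map f z) :=
  le_antisymm (iSup₂_le fun _ y => φ.right_le x y _)
    (le_iSup₂_of_le q (QFunctor.map f z) (Y.comp_id_le _ _))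

theorem lowerStar_comp_val {X Y Z : QCat Q} (f : X ⟶ Y) (φ : QDist Y Z) {p q : Q} (x : X.fib p)
    (z : Z.fib q) : ((lowerStar f).comp φ).val x z = φ.val (QFunctor.map f x) z :=
  le_antisymm (iSup₂_le fun _ y => φ.left_le _ y z)
    (le_iSup₂_of_le p (QFunctor.map f x) (Y.id_comp_le _ _))

theorem map_comp_apply (T : QCat Q ⥤ QCat Q) {X Y Z : QCat Q} (f : X ⟶ Y) (g : Y ⟶ Z) {p : Q}
    (x : (T.obj X).fib p) :
    QFunctor.map (T.map (f ≫ g)) x = QFunctor.map (T.map g) (QFunctor.map (T.map f) x) := by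
  rw [T.map_comp]; rfl

theorem nat_apply {S T : QCat Q ⥤ QCat Q} (α : S ⟶ T) {X Y : QCat Q} (f : X ⟶ Y) {p : Q}
    (x : (S.obj X).fib p) :
    QFunctor.map (α.app Y) (QFunctor.map (S.map f) x)
      = QFunctor.map (T.map f) (QFunctor.map (α.app X) x) :=
  congrArg (fun g : S.obj X ⟶ T.obj Y => QFunctor.map g x) (α.naturality f)

theorem hom_le_of_le_right {X Y : QCat Q} {f g : X ⟶ Y} (h : f ≤ g) {p q : Q} (y : Y.fib p)
    (x : X.fib q) : Y.hom y (QFunctor.map f x) ≤ Y.hom y (QFunctor.map g x) := by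
  refine le_trans ?_ (Y.comp_le y (QFunctor.map f x) (QFunctor.map g x))
  simpa using comp_mono (le_refl (Y.hom y (QFunctor.map f x))) (h q x)

theorem hom_le_of_le_left {X Y : QCat Q} {f g : X ⟶ Y} (h : f ≤ g) {p q : Q} (x : X.fib p)
    (y : Y.fib q) : Y.hom (QFunctor.map g x) y ≤ Y.hom (QFunctor.map f x) y := by
  refine le_trans ?_ (Y.comp_le (QFunctor.map f x) (QFunctor.map g x) y)
  simpa using comp_mono (h p x) (le_refl (Y.hom (QFunctor.map g x) y))

/-- Every distributor is the graph of the Yoneda functor followed by the cograph of its transpose. -/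
theorem yoneda_comp_transposeL {X Y : QCat Q} (φ : QDist X Y) :
    (lowerStar (yoneda X)).comp (upperStar (transposeL φ)) = φ :=
  QDist.ext' fun _ _ x y =>
    (comp_upperStar_val _ _ x y).trans (yoneda_hom x (QFunctor.map (transposeL φ) y))

/-! ### The minimal extension -/

theorem barExt_val (T : QCat Q ⥤ QCat Q) {X Y : QCat Q} (φ : QDist X Y) {p q : Q}
    (a : (T.obj X).fib p) (b : (T.obj Y).fib q) :
    (barExt T X Y φ).val a b = (T.obj (PObj X)).hom (QFunctor.map (T.map (yoneda X)) a)
      (QFunctor.map (T.map (transposeL φ)) b) :=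
  comp_upperStar_val _ _ a b

theorem transposeL_mono {X Y : QCat Q} {φ ψ : QDist X Y} (h : φ ≤ ψ) :
    transposeL φ ≤ transposeL ψ := fun _ _ => Presheaf.le_hom.2 fun _ _ => by
  rw [Category.comp_id]; exact h _ _ _ _

theorem transposeL_comp {X Y Z : QCat Q} (φ : QDist X Y) (ψ : QDist Y Z) :
    transposeL (φ.comp ψ) = transposeL ψ ≫ odot φ := rfl

/-- `φ^⊙` extends the transpose of `φ` along Yoneda. Together with `transposeL_comp` it lets `T
(φ^⊙)` move both homs of a composite into one category, which yields lax functoriality of `barExt`.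
-/
theorem yoneda_odot {X Y : QCat Q} (φ : QDist X Y) : yoneda Y ≫ odot φ = transposeL φ :=
  hom_ext fun _ y => Presheaf.ext' fun _ x =>
    comp_upperStar_val φ (𝟙 Y) x y

/-- The minimal extension of a 2-functor is a lax extension. -/
theorem isLaxExtension_barExt {T : QCat Q ⥤ QCat Q}
    (hT : ∀ {X Y : QCat Q} (f g : X ⟶ Y), f ≤ g → T.map f ≤ T.map g) :
    IsLaxExtension T (barExt T) where
  mono φ ψ h p q a b := by
    rw [barExt_val, barExt_val]
    exact hom_le_of_le_right (hT _ _ (transposeL_mono h)) _ _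
  id_le X p q a b := by
    rw [barExt_val]
    exact QFunctor.hom_le (T.map (yoneda X)) a b
  comp_le {X Y Z} φ ψ p q a c := by
    refine iSup₂_le fun r b => ?_
    rw [barExt_val, barExt_val, barExt_val, transposeL_comp, map_comp_apply, ← yoneda_odot φ,
      map_comp_apply]
    exact (comp_mono le_rfl (QFunctor.hom_le (T.map (odot φ)) _ _)).trans
      ((T.obj (PObj X)).comp_le _ _ _)
  lower_le {X Y} f p q a b := by
    rw [barExt_val]
    -- The unit of the adjunction between `f_*` and `f^*`: the hom of `X` is below `b(f -, f -)`.
    -- Homs are antitone in the first variable, so the larger functor can replace `yoneda X`.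
    have h : yoneda X ≤ f ≫ transposeL (lowerStar f) := fun _ x => Presheaf.le_hom.2 fun _ z => by
      rw [Category.comp_id]; exact QFunctor.hom_le f z x
    refine le_trans ?_ (hom_le_of_le_left (hT _ _ h) _ _)
    rw [map_comp_apply]
    exact QFunctor.hom_le (T.map (transposeL (lowerStar f))) _ _
  upper_le {X Y} f p q a b := by
    rw [barExt_val]
    have h : transposeL (upperStar f) = f ≫ yoneda Y := rfl
    rw [h, map_comp_apply]
    exact QFunctor.hom_le (T.map (yoneda Y)) _ _

/-- The minimal extension of a 2-functor preserving full faithfulness of the Yoneda functors is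
flat. -/
theorem isFlatLaxExtension_barExt {T : QCat Q ⥤ QCat Q}
    (hT : ∀ {X Y : QCat Q} (f g : X ⟶ Y), f ≤ g → T.map f ≤ T.map g)
    (hy : ∀ X : QCat Q, FullyFaithful (T.map (yoneda X))) :
    IsFlatLaxExtension T (barExt T) where
  toIsLaxExtension := isLaxExtension_barExt hT
  lower_eq {X Y} f := by
    refine QDist.le_antisymm ((isLaxExtension_barExt hT).lower_le f) fun p q a b => ?_
    rw [barExt_val]
    -- Pushing forward along `T (f_!)` turns a hom over `𝒫 X` into one over `𝒫 Y`. There the first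
    -- argument comes from `f ≫ yoneda Y`, and the second is bounded by `T (yoneda Y)` through the
    -- counit of the same adjunction; full faithfulness of `T (yoneda Y)` then removes Yoneda.
    refine (QFunctor.hom_le (T.map (odot (upperStar f))) _ _).trans ?_
    have h : transposeL (lowerStar f) ≫ odot (upperStar f) ≤ yoneda Y := fun q y =>
      Presheaf.le_hom.2 fun _ z => by
        rw [Category.comp_id]
        exact iSup₂_le fun r x => Y.comp_le _ _ _
    have h' : yoneda X ≫ odot (upperStar f) = f ≫ yoneda Y :=
      hom_ext fun q x => PFun_map_yoneda f x
    rw [← map_comp_apply, ← map_comp_apply, h', map_comp_apply]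
    refine (hom_le_of_le_right (hT _ _ h) _ _).trans ?_
    exact (hy Y _ _ _ _).ge
  upper_eq {X Y} f := by
    refine QDist.ext' fun p q a b => ?_
    rw [barExt_val]
    have h : transposeL (upperStar f) = f ≫ yoneda Y := rfl
    rw [h, map_comp_apply]
    exact hy Y _ _ _ _

/-- A lax extension preserves composition with cographs. -/
theorem IsLaxExtension.comp_upperStar {T : QCat Q ⥤ QCat Q} {E : DistMap T}
    (hE : IsLaxExtension T E) {X Y Z : QCat Q} (φ : QDist X Y) (f : Z ⟶ Y) :
    E X Z (φ.comp (upperStar f)) = (E X Y φ).comp (upperStar (T.map f)) := by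
  refine QDist.le_antisymm (fun p q a b => ?_) ?_
  · rw [comp_upperStar_val]
    -- The counit inequality for `f`. Composing `E (φ.comp f^*)` with `E (f_*)`, which dominates `(T
    -- f)_*`, brings the value back under `E φ`.
    have h : (φ.comp (upperStar f)).comp (lowerStar f) ≤ φ := fun p q x y => by
      refine iSup₂_le fun r z => ?_
      rw [comp_upperStar_val]
      exact φ.right_le _ _ _
    refine le_trans ?_ (hE.mono _ _ h p q a (QFunctor.map (T.map f) b))
    refine le_trans ?_ (hE.comp_le _ _ p q a (QFunctor.map (T.map f) b))
    refine le_iSup₂_of_le q b ?_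
    exact ((T.obj Y).comp_id_le _ _).trans (comp_mono le_rfl (hE.lower_le f _ _ _ _))
  · exact QDist.le_trans (QDist.comp_mono (QDist.le_refl _) (hE.upper_le f)) (hE.comp_le _ _)

/-- A flat lax extension of `T` is the minimal extension. -/
theorem IsFlatLaxExtension.eq_barExt {T : QCat Q ⥤ QCat Q} {E : DistMap T}
    (hE : IsFlatLaxExtension T E) : E = barExt T := by
  funext X Y φ
  -- After this decomposition the cograph factor is preserved by any lax extension and the graph
  -- factor by flatness.
  conv_lhs => rw [← yoneda_comp_transposeL φ]
  rw [hE.toIsLaxExtension.comp_upperStar, ← hE.lower_eq]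
  rfl

/-- A flat extension of `T` sends a minimal extension along `S` to the one along the composite. -/
theorem barExt_comp {S T : QCat Q ⥤ QCat Q} (hT : IsFlatLaxExtension T (barExt T))
    {X Y : QCat Q} (φ : QDist X Y) :
    barExt (S ⋙ T) X Y φ = barExt T (S.obj X) (S.obj Y) (barExt S X Y φ) := by
  conv_rhs => rw [barExt.eq_def S]
  rw [hT.toIsLaxExtension.comp_upperStar, ← hT.lower_eq]
  rfl

/-- The minimal extension of a 2-monad is a lax extension of the 2-monad as soon as it is flat. -/
theorem isMonadLaxExtension_barExt {T : QCat Q ⥤ QCat Q} (M : TwoMonad T)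
    (hT : IsFlatLaxExtension T (barExt T)) : IsMonadLaxExtension M (barExt T) where
  toIsLaxExtension := hT.toIsLaxExtension
  mult_oplax {X Y} φ p q a b := by
    refine iSup₂_le fun r c => ?_
    -- Flatness is needed only here: it makes the iterated extension the minimal extension of `T ⋙
    -- T`, hence a single hom in `T (T (𝒫 X))`. The multiplication at `𝒫 X` maps that hom into `T (𝒫
    -- X)`, where naturality applies.
    rw [← barExt_comp hT, lowerStar_comp_val, barExt_val, barExt_val]
    refine (comp_mono (QFunctor.hom_le (M.mult.app (PObj X)) _ _)
      (QFunctor.hom_le (T.map (transposeL φ)) _ _)).trans ?_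
    have h₁ := nat_apply M.mult (yoneda X) a
    have h₂ := nat_apply M.mult (transposeL φ) c
    erw [h₁, h₂]
    exact (T.obj (PObj X)).comp_le _ _ _
  unit_oplax {X Y} φ p q x b := by
    refine iSup₂_le fun r y => ?_
    rw [lowerStar_comp_val, barExt_val]
    have h₁ := nat_apply M.unit (yoneda X) x
    have h₂ := nat_apply M.unit (transposeL φ) y
    have h₃ : φ.val x y ≤ (PObj X).hom (QFunctor.map (yoneda X) x)
        (QFunctor.map (transposeL φ) y) := (yoneda_hom x (QFunctor.map (transposeL φ) y)).ge
    refine (comp_mono (h₃.trans (QFunctor.hom_le (M.unit.app (PObj X)) _ _))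
      (QFunctor.hom_le (T.map (transposeL φ)) _ _)).trans ?_
    erw [h₁, h₂]
    exact (T.obj (PObj X)).comp_le _ _ _

/-! ### Full faithfulness -/

theorem FullyFaithful.odot_lower_upper {X Y : QCat Q} {f : X ⟶ Y} (hf : FullyFaithful f) {s : Q}
    (σ : Presheaf X s) : odotVal (lowerStar f) (odotVal (upperStar f) σ) = σ := by
  refine Eq.trans (Presheaf.ext' fun q x => ?_) (odot_id σ)
  rw [odot_lower_val]
  exact iSup_congr fun p => iSup_congr fun z => by
    rw [show (upperStar f).val (QFunctor.map f x) z = X.hom x z from (hf _ _ x z).symm]; rfl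

theorem FullyFaithful.oplus_upper_lower {X Y : QCat Q} {f : X ⟶ Y} (hf : FullyFaithful f) {s : Q}
    (σ : Copresheaf X s) : oplusVal (upperStar f) (oplusVal (lowerStar f) σ) = σ := by
  refine Eq.trans (Copresheaf.ext' fun q x => ?_) (oplus_id σ)
  rw [oplus_upper_val]
  exact iSup_congr fun p => iSup_congr fun z => by
    rw [show (lowerStar f).val z (QFunctor.map f x) = X.hom z x from (hf _ _ z x).symm]; rfl

theorem FullyFaithful.odot_upper_val {X Y : QCat Q} {f : X ⟶ Y} (hf : FullyFaithful f) {s q : Q}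
    (σ : Presheaf X s) (x : X.fib q) :
    (odotVal (upperStar f) σ).val (QFunctor.map f x) = σ.val x := by
  rw [← odot_lower_val, hf.odot_lower_upper]

theorem FullyFaithful.oplus_lower_val {X Y : QCat Q} {f : X ⟶ Y} (hf : FullyFaithful f) {s q : Q}
    (σ : Copresheaf X s) (x : X.fib q) :
    (oplusVal (lowerStar f) σ).val (QFunctor.map f x) = σ.val x := by
  rw [← oplus_upper_val, hf.oplus_upper_lower]

theorem FullyFaithful.odot {X Y : QCat Q} {f : X ⟶ Y} (hf : FullyFaithful f) :
    FullyFaithful (odot (upperStar f)) := fun p q σ τ => by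
  refine le_antisymm (QFunctor.hom_le (QEnr.odot (upperStar f)) σ τ) ?_
  refine (QFunctor.hom_le (QEnr.odot (lowerStar f)) _ _).trans (le_of_eq ?_)
  exact congrArg₂ _ (hf.odot_lower_upper σ) (hf.odot_lower_upper τ)

theorem FullyFaithful.oplus {X Y : QCat Q} {f : X ⟶ Y} (hf : FullyFaithful f) :
    FullyFaithful (oplus (lowerStar f)) := fun p q σ τ => by
  refine le_antisymm (QFunctor.hom_le (QEnr.oplus (lowerStar f)) σ τ) ?_
  refine (QFunctor.hom_le (QEnr.oplus (upperStar f)) _ _).trans (le_of_eq ?_)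
  exact congrArg₂ _ (hf.oplus_upper_lower σ) (hf.oplus_upper_lower τ)

theorem FullyFaithful.HFun_map {X Y : QCat Q} {f : X ⟶ Y} (hf : FullyFaithful f) :
    FullyFaithful ((HFun Q).map f) := fun p q σ τ => hf.odot p q σ.1 τ.1

theorem FullyFaithful.HdFun_map {X Y : QCat Q} {f : X ⟶ Y} (hf : FullyFaithful f) :
    FullyFaithful ((HdFun Q).map f) := fun p q σ τ => hf.oplus p q σ.1 τ.1

theorem fullyFaithful_yoneda (X : QCat Q) : FullyFaithful (yoneda X) :=
  fun _ _ x y => (yoneda_hom x (QFunctor.map (yoneda X) y)).symm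

theorem fullyFaithful_inclH (X : QCat Q) : FullyFaithful ((inclH Q).app X) := fun _ _ _ _ => rfl

theorem fullyFaithful_inclHd (X : QCat Q) : FullyFaithful ((inclHd Q).app X) := fun _ _ _ _ => rfl

theorem HFun_mono {X Y : QCat Q} (f g : X ⟶ Y) (h : f ≤ g) : (HFun Q).map f ≤ (HFun Q).map g :=
  fun s σ => PFun_mono f g h s σ.1

theorem HdFun_mono {X Y : QCat Q} (f g : X ⟶ Y) (h : f ≤ g) : (HdFun Q).map f ≤ (HdFun Q).map g :=
  fun s σ => PdFun_mono f g h s σ.1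

/-! ### Sub-2-monads -/

theorem FullyFaithful.le_of_comp_le {X Y Z : QCat Q} {i : Y ⟶ Z} (hi : FullyFaithful i)
    {f g : X ⟶ Y} (h : f ≫ i ≤ g ≫ i) : f ≤ g :=
  fun q x => (h q x).trans (hi _ _ _ _).ge

theorem ObjInjective.cancel {X Y Z : QCat Q} {i : Y ⟶ Z} (hi : ObjInjective i) {f g : X ⟶ Y}
    (h : f ≫ i = g ≫ i) : f = g :=
  hom_ext fun q x => hi q _ _ (congrArg (fun k : X ⟶ Z => QFunctor.map k x) h)

/-- A functor into `Z` whose values lie in the image of a fully faithful functor `i` factors through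
`i`. -/
theorem FullyFaithful.exists_lift {X Y Z : QCat Q} {i : Y ⟶ Z} (hi : FullyFaithful i) (f : X ⟶ Z)
    (h : ∀ (q : Q) (x : X.fib q), ∃ y : Y.fib q, QFunctor.map i y = QFunctor.map f x) :
    ∃ g : X ⟶ Y, g ≫ i = f := by
  choose g hg using h
  refine ⟨⟨fun {q} x => g q x, fun {p q} x x' => ?_⟩, hom_ext fun q x => hg q x⟩
  rw [hi, hg, hg]
  exact QFunctor.hom_le f x x'

/-- A subfunctor of a 2-monad which contains the unit and is closed under the multiplication is a
sub-2-monad. -/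
theorem exists_isSubTwoMonad {S T : QCat Q ⥤ QCat Q} (N : TwoMonad T) (ι : S ⟶ T)
    (hff : ∀ X, FullyFaithful (ι.app X)) (hinj : ∀ X, ObjInjective (ι.app X))
    (e : ∀ X, X ⟶ S.obj X) (he : ∀ X, e X ≫ ι.app X = N.unit.app X)
    (hm : ∀ (X : QCat Q) (s : Q) (W : (S.obj (S.obj X)).fib s), ∃ V : (S.obj X).fib s,
      QFunctor.map (ι.app X) V
        = QFunctor.map (ι.app (S.obj X) ≫ T.map (ι.app X) ≫ N.mult.app X) W) :
    ∃ M : TwoMonad S, IsSubTwoMonad M N ι ∧ (∀ X, M.unit.app X = e X) ∧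
      ∀ X, M.mult.app X ≫ ι.app X = ι.app (S.obj X) ≫ T.map (ι.app X) ≫ N.mult.app X := by
  choose m hmι using fun X => (hff X).exists_lift _ (hm X)
  have hη {X Y : QCat Q} (f : X ⟶ Y) : f ≫ N.unit.app Y = N.unit.app X ≫ T.map f :=
    N.unit.naturality f
  have hμ {X Y : QCat Q} (f : X ⟶ Y) :
      T.map (T.map f) ≫ N.mult.app Y = N.mult.app X ≫ T.map f := N.mult.naturality f
  -- `ι` reflects the order and can be cancelled on the right, so each law is checked after
  -- composing with `ι`, where it becomes the corresponding law of `N`.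
  let M : TwoMonad S :=
    { map_mono := fun {X Y} f g h => by
        refine (hff Y).le_of_comp_le ?_
        rw [ι.naturality, ι.naturality]
        exact fun q x => N.map_mono f g h q _
      unit :=
        { app := e
          naturality := fun X Y f => (hinj Y).cancel (by
            change (f ≫ e Y) ≫ ι.app Y = (e X ≫ S.map f) ≫ ι.app Y
            rw [Category.assoc, Category.assoc, he, ι.naturality, ← Category.assoc, he]
            exact hη f) }
      mult :=
        { app := m
          naturality := fun X Y f => (hinj Y).cancel (by
            simp only [Functor.comp_map, Category.assoc, ι.naturality, hmι]
            rw [← Category.assoc (m X), hmι, ι.naturality_assoc]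
            simp only [Category.assoc, ← hμ]
            simp only [← Category.assoc, ← Functor.map_comp, ι.naturality]) }
      left_unit := fun X => (hinj X).cancel (by
        change (e (S.obj X) ≫ m X) ≫ ι.app X = 𝟙 (S.obj X) ≫ ι.app X
        rw [Category.assoc, hmι, ← Category.assoc, he, ← Category.assoc, ← hη, Category.assoc,
          N.left_unit, Category.comp_id, Category.id_comp])
      right_unit := fun X => (hinj X).cancel (by
        change (S.map (e X) ≫ m X) ≫ ι.app X = 𝟙 (S.obj X) ≫ ι.app X
        rw [Category.assoc, hmι, ι.naturality_assoc, ← T.map_comp_assoc, he, N.right_unit,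
          Category.comp_id, Category.id_comp])
      assoc := fun X => (hinj X).cancel (by
        rw [Category.assoc, Category.assoc, hmι, ι.naturality_assoc, ← T.map_comp_assoc, hmι,
          ← Category.assoc (m _), hmι]
        simp only [T.map_comp, Category.assoc]
        rw [N.assoc, ← Category.assoc (N.mult.app _) (T.map _), ← hμ, Category.assoc]
        rfl) }
  refine ⟨M, ⟨⟨⟨ι, he, fun X => ?_⟩, rfl⟩, hff, hinj⟩, fun _ => rfl, hmι⟩
  refine (hmι X).trans ((Category.assoc _ _ _).symm.trans ?_)
  -- A morphism of monads writes the square of `ι` as `S.map` followed by `ι`; `hmι` uses the other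
  -- order, and naturality identifies them.
  exact congrArg (· ≫ N.mult.app X) (ι.naturality (ι.app X)).symm

/-! ### Conical presheaves and copresheaves -/

/-- The conical presheaf generated by a set of objects. -/
def coneH {X : QCat Q} {s : Q} (A : Set (X.fib s)) : (HObj X).fib s :=
  ⟨⟨fun z => ⨆ x ∈ A, X.hom z x, fun z z' => by
    simp only [comp_iSup]
    exact iSup₂_mono fun x _ => X.comp_le _ _ _⟩, A, fun _ _ => rfl⟩

/-- The conical copresheaf generated by a set of objects. -/
def coneHd {X : QCat Q} {s : Q} (A : Set (X.fib s)) : (HdObj X).fib s :=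
  ⟨⟨fun z => ⨆ x ∈ A, X.hom x z, fun z z' => by
    simp only [iSup_comp]
    exact iSup₂_mono fun x _ => X.comp_le _ _ _⟩, A, fun _ _ => rfl⟩

/-- Pushforward along `f` preserves joins and sends representables to representables, so it carries
generators to their images. The formula also evaluates at objects outside the image of `f`, such as
non-conical copresheaves. -/
theorem odot_upper_val_of_conical {X Y : QCat Q} (f : X ⟶ Y) {s : Q} {σ : Presheaf X s}
    {A : Set (X.fib s)} (hA : ∀ (q : Q) (z : X.fib q), σ.val z = ⨆ x ∈ A, X.hom z x) {q : Q}
    (y : Y.fib q) :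
    (odotVal (upperStar f) σ).val y = ⨆ x ∈ A, Y.hom y (QFunctor.map f x) := by
  refine le_antisymm (iSup₂_le fun p z => ?_) (iSup₂_le fun x hx => ?_)
  · simp only [hA, comp_iSup]
    exact iSup₂_mono fun x _ =>
      (comp_mono le_rfl (QFunctor.hom_le f z x)).trans (Y.comp_le _ _ _)
  · refine le_iSup₂_of_le s x ((X.comp_id_le x _).trans (comp_mono le_rfl ?_))
    rw [hA]
    exact le_iSup₂_of_le x hx le_rfl

theorem oplus_lower_val_of_conical {X Y : QCat Q} (f : X ⟶ Y) {s : Q} {τ : Copresheaf X s}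
    {A : Set (X.fib s)} (hA : ∀ (q : Q) (z : X.fib q), τ.val z = ⨆ x ∈ A, X.hom x z) {q : Q}
    (y : Y.fib q) :
    (oplusVal (lowerStar f) τ).val y = ⨆ x ∈ A, Y.hom (QFunctor.map f x) y := by
  refine le_antisymm (iSup₂_le fun p z => ?_) (iSup₂_le fun x hx => ?_)
  · simp only [hA, iSup_comp]
    exact iSup₂_mono fun x _ =>
      (comp_mono (QFunctor.hom_le f x z) le_rfl).trans (Y.comp_le _ _ _)
  · refine le_iSup₂_of_le s x ((X.id_comp_le x _).trans (comp_mono ?_ le_rfl))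
    rw [hA]
    exact le_iSup₂_of_le x hx le_rfl

/-- The hom turns the join of generators into a meet, and the Yoneda lemma evaluates each term. -/
theorem Presheaf.hom_of_conical {X : QCat Q} {s t : Q} {σ : Presheaf X s} {A : Set (X.fib s)}
    (hA : ∀ (q : Q) (z : X.fib q), σ.val z = ⨆ x ∈ A, X.hom z x) (κ : Presheaf X t) :
    σ.hom κ = ⨅ x ∈ A, κ.val x := by
  refine le_antisymm (le_iInf₂ fun x hx => ?_) (Presheaf.le_hom.2 fun q z => ?_)
  · refine (X.id_comp_le x _).trans ((comp_mono ?_ le_rfl).trans (σ.val_comp_hom κ x))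
    rw [hA]
    exact le_iSup₂_of_le x hx le_rfl
  · simp only [hA, iSup_comp]
    exact iSup₂_le fun x hx => (comp_mono le_rfl (iInf₂_le x hx)).trans (κ.compat z x)

theorem Copresheaf.hom_of_conical {X : QCat Q} {s t : Q} {τ : Copresheaf X s} {A : Set (X.fib s)}
    (hA : ∀ (q : Q) (z : X.fib q), τ.val z = ⨆ x ∈ A, X.hom x z) (κ : Copresheaf X t) :
    κ.hom τ = ⨅ x ∈ A, κ.val x := by
  refine le_antisymm (le_iInf₂ fun x hx => ?_) (Copresheaf.le_hom.2 fun q z => ?_)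
  · refine (X.comp_id_le x _).trans ((comp_mono le_rfl ?_).trans (κ.hom_comp_val τ x))
    rw [hA]
    exact le_iSup₂_of_le x hx le_rfl
  · simp only [hA, comp_iSup]
    exact iSup₂_le fun x hx => (comp_mono (iInf₂_le x hx) le_rfl).trans (κ.compat x z)

/-- The hom into the copresheaf generated by a union is an infimum. -/
theorem Copresheaf.hom_coneHd_iUnion {X : QCat Q} {s t : Q} {I : Type u} (C : I → (HdObj X).fib s)
    (A : I → Set (X.fib s))
    (hA : ∀ (i : I) (q : Q) (z : X.fib q), (C i).1.val z = ⨆ x ∈ A i, X.hom x z)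
    (κ : Copresheaf X t) : κ.hom (coneHd (⋃ i, A i)).1 = ⨅ i, κ.hom (C i).1 := by
  rw [Copresheaf.hom_of_conical (A := ⋃ i, A i) (fun _ _ => rfl), iInf_iUnion]
  exact iInf_congr fun i => (Copresheaf.hom_of_conical (hA i) κ).symm

/-- The hom out of the presheaf generated by a union is an infimum. -/
theorem Presheaf.hom_coneH_iUnion {X : QCat Q} {s t : Q} {I : Type u} (C : I → (HObj X).fib s)
    (A : I → Set (X.fib s))
    (hA : ∀ (i : I) (q : Q) (z : X.fib q), (C i).1.val z = ⨆ x ∈ A i, X.hom z x)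
    (κ : Presheaf X t) : (coneH (⋃ i, A i)).1.hom κ = ⨅ i, (C i).1.hom κ := by
  rw [Presheaf.hom_of_conical (A := ⋃ i, A i) (fun _ _ => rfl), iInf_iUnion]
  exact iInf_congr fun i => (Presheaf.hom_of_conical (hA i) κ).symm

/-! ### The double Hausdorff 2-monads -/

theorem fullyFaithful_inclHd_inclH (X : QCat Q) : FullyFaithful ((inclHd Q ◫ inclH Q).app X) :=
  fun p q σ τ => (fullyFaithful_inclHd X).odot p q σ.1 τ.1

theorem fullyFaithful_inclH_inclHd (X : QCat Q) : FullyFaithful ((inclH Q ◫ inclHd Q).app X) :=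
  fun p q σ τ => (fullyFaithful_inclH X).oplus p q σ.1 τ.1

/-- Restriction along the fully faithful inclusion is a left inverse of pushforward along it. -/
theorem objInjective_inclHd_inclH (X : QCat Q) : ObjInjective ((inclHd Q ◫ inclH Q).app X) :=
  fun q σ τ h => Subtype.ext <| by
    have := congrArg (odotVal (lowerStar ((inclHd Q).app X))) h
    rwa [← (fullyFaithful_inclHd X).odot_lower_upper σ.1,
      ← (fullyFaithful_inclHd X).odot_lower_upper τ.1]

theorem objInjective_inclH_inclHd (X : QCat Q) : ObjInjective ((inclH Q ◫ inclHd Q).app X) :=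
  fun q σ τ h => Subtype.ext <| by
    have := congrArg (oplusVal (upperStar ((inclH Q).app X))) h
    rwa [← (fullyFaithful_inclH X).oplus_upper_lower σ.1,
      ← (fullyFaithful_inclH X).oplus_upper_lower τ.1]

/-- The copresheaf `V ↦ V(τ)` on `ℋℋ†X`. -/
def evHHd {X : QCat Q} {t : Q} (τ : Copresheaf X t) : Copresheaf (HObj (HdObj X)) t :=
  oplusVal (upperStar ((inclHd Q ◫ inclH Q).app X)) (evL τ)

/-- The presheaf `V ↦ V(τ)` on `ℋ†ℋX`. -/
def evHdH {X : QCat Q} {t : Q} (τ : Presheaf X t) : Presheaf (HdObj (HObj X)) t :=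
  odotVal (lowerStar ((inclH Q ◫ inclHd Q).app X)) (evR τ)

theorem evHHd_val {X : QCat Q} {s t : Q} (τ : Copresheaf X t) (V : (HObj (HdObj X)).fib s) :
    (evHHd τ).val V = (odotVal (upperStar ((inclHd Q).app X)) V.1).val τ :=
  (oplus_upper_val _ _ V).trans (evL_val τ _)

theorem evHdH_val {X : QCat Q} {s t : Q} (τ : Presheaf X t) (V : (HdObj (HObj X)).fib s) :
    (evHdH τ).val V = (oplusVal (lowerStar ((inclH Q).app X)) V.1).val τ :=
  (odot_lower_val _ _ V).trans (evR_val τ _)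

/-! ### Closure of the conical elements under multiplication -/

theorem doublePresheaf_mult_val {X : QCat Q} {s t : Q}
    (W : (HObj (HdObj (HObj (HdObj X)))).fib s) (τ : Copresheaf X t) :
    (QFunctor.map ((inclHd Q ◫ inclH Q).app (HObj (HdObj X)) ≫
      (PdFun Q ⋙ PFun Q).map ((inclHd Q ◫ inclH Q).app X) ≫ (doublePresheaf Q).mult.app X) W :
        Presheaf (PdObj X) s).val τ
      = (odotVal (upperStar ((inclHd Q).app (HObj (HdObj X)))) W.1).val (evHHd τ) :=
  (PPdMult_val _ τ).trans (PPd_map_val ((inclHd Q ◫ inclH Q).app X) _ (evL τ))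

theorem doubleCopresheaf_mult_val {X : QCat Q} {s t : Q}
    (W : (HdObj (HObj (HdObj (HObj X)))).fib s) (τ : Presheaf X t) :
    (QFunctor.map ((inclH Q ◫ inclHd Q).app (HdObj (HObj X)) ≫
      (PFun Q ⋙ PdFun Q).map ((inclH Q ◫ inclHd Q).app X) ≫ (doubleCopresheaf Q).mult.app X) W :
        Copresheaf (PObj X) s).val τ
      = (oplusVal (lowerStar ((inclH Q).app (HdObj (HObj X)))) W.1).val (evHdH τ) :=
  (PdPMult_val _ τ).trans (PdP_map_val ((inclH Q ◫ inclHd Q).app X) _ (evR τ))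

/-- Unfolding generators, the value at `τ` is the join over `C` in `𝒞`, of the meet over `V` in `𝒮
C`, of the join over `A` in `𝒜 V`, of the homs from `τ` to `A`. Complete distributivity replaces the
inner meet of joins by a join over choice functions of meets. -/
theorem exists_HHd_mult (hQ : IsCompletelyDistributive Q) (X : QCat Q) (s : Q)
    (W : (HObj (HdObj (HObj (HdObj X)))).fib s) : ∃ V : (HObj (HdObj X)).fib s,
      QFunctor.map ((inclHd Q ◫ inclH Q).app X) V
        = QFunctor.map ((inclHd Q ◫ inclH Q).app (HObj (HdObj X)) ≫
          (PdFun Q ⋙ PFun Q).map ((inclHd Q ◫ inclH Q).app X) ≫ (doublePresheaf Q).mult.app X)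
          W := by
  obtain ⟨𝒞, h𝒞⟩ := W.2
  choose 𝒮 h𝒮 using fun C : (HdObj (HObj (HdObj X))).fib s => C.2
  choose 𝒜 h𝒜 using fun V : (HObj (HdObj X)).fib s => V.2
  choose B hB using fun A : (HdObj X).fib s => A.2
  -- A generator of the product is a `C` with a choice of one `A` in `𝒜 V` for each `V` in `𝒮 C`.
  -- Homs into a cone on a union are meets, so the cone on all the sets `B` of the chosen
  -- copresheaves realises the meet of their homs.
  let D (i : Σ C : 𝒞, ∀ V : 𝒮 C, 𝒜 V) : (HdObj X).fib s := coneHd (⋃ V, B (i.2 V))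
  refine ⟨coneH (Set.range D), Presheaf.ext' fun t τ => Eq.trans ?_
    (doublePresheaf_mult_val W τ).symm⟩
  refine (odot_upper_val_of_conical _ (A := Set.range D) (fun _ _ => rfl) τ).trans ?_
  refine Eq.trans ?_ (odot_upper_val_of_conical _ h𝒞 _).symm
  rw [iSup_range, iSup_sigma, iSup_subtype']
  refine iSup_congr fun C => Eq.symm ?_
  refine (Copresheaf.hom_of_conical (h𝒮 C) (evHHd τ)).trans ?_
  rw [iInf_subtype']
  -- Distributivity is applied in the hom-lattice from `t` to `s`: all generators have the type `s`
  -- of `W`, while `τ` has an arbitrary type `t`.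
  refine Eq.trans (iInf_congr fun V => ?_) ((hQ t s (𝒮 C) (fun V => 𝒜 V)
    fun V A => τ.hom A.1.1).trans (iSup_congr fun f => ?_))
  · exact (evHHd_val τ V.1).trans ((odot_upper_val_of_conical _ (h𝒜 V) τ).trans iSup_subtype')
  · exact (Copresheaf.hom_coneHd_iUnion (fun V => (f V).1) _ (fun V => hB (f V)) τ).symm

/-- The dual argument, with homs out of cones in place of homs into them and distributivity in the
lattice from `s` to `t`. -/
theorem exists_HdH_mult (hQ : IsCompletelyDistributive Q) (X : QCat Q) (s : Q)
    (W : (HdObj (HObj (HdObj (HObj X)))).fib s) : ∃ V : (HdObj (HObj X)).fib s,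
      QFunctor.map ((inclH Q ◫ inclHd Q).app X) V
        = QFunctor.map ((inclH Q ◫ inclHd Q).app (HdObj (HObj X)) ≫
          (PFun Q ⋙ PdFun Q).map ((inclH Q ◫ inclHd Q).app X) ≫ (doubleCopresheaf Q).mult.app X)
          W := by
  obtain ⟨𝒞, h𝒞⟩ := W.2
  choose 𝒮 h𝒮 using fun C : (HObj (HdObj (HObj X))).fib s => C.2
  choose 𝒜 h𝒜 using fun V : (HdObj (HObj X)).fib s => V.2
  choose B hB using fun A : (HObj X).fib s => A.2
  let D (i : Σ C : 𝒞, ∀ V : 𝒮 C, 𝒜 V) : (HObj X).fib s := coneH (⋃ V, B (i.2 V))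
  refine ⟨coneHd (Set.range D), Copresheaf.ext' fun t τ => Eq.trans ?_
    (doubleCopresheaf_mult_val W τ).symm⟩
  refine (oplus_lower_val_of_conical _ (A := Set.range D) (fun _ _ => rfl) τ).trans ?_
  refine Eq.trans ?_ (oplus_lower_val_of_conical _ h𝒞 _).symm
  rw [iSup_range, iSup_sigma, iSup_subtype']
  refine iSup_congr fun C => Eq.symm ?_
  refine (Presheaf.hom_of_conical (h𝒮 C) (evHdH τ)).trans ?_
  rw [iInf_subtype']
  refine Eq.trans (iInf_congr fun V => ?_) ((hQ s t (𝒮 C) (fun V => 𝒜 V)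
    fun V A => A.1.1.hom τ).trans (iSup_congr fun f => ?_))
  · exact (evHdH_val τ V.1).trans ((oplus_lower_val_of_conical _ (h𝒜 V) τ).trans iSup_subtype')
  · exact (Presheaf.hom_coneH_iUnion (fun V => (f V).1) _ (fun V => hB (f V)) τ).symm

/-- Identifies the inherited multiplication with the intrinsic formula. Pushforward along a fully
faithful inclusion does not change values at conical arguments, and for conical `τ` the evaluation
`evHHd` is, by the Yoneda lemma, the copresheaf represented by the representable at `τ`. -/
theorem HHd_mult_eq {X : QCat Q} {s : Q} (W : (HObj (HdObj (HObj (HdObj X)))).fib s)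
    (V : (HObj (HdObj X)).fib s)
    (h : QFunctor.map ((inclHd Q ◫ inclH Q).app X) V
      = QFunctor.map ((inclHd Q ◫ inclH Q).app (HObj (HdObj X)) ≫
        (PdFun Q ⋙ PFun Q).map ((inclHd Q ◫ inclH Q).app X) ≫ (doublePresheaf Q).mult.app X) W) :
    V.1 = odotVal (lowerStar (yonedaH (HdObj X) ≫ coyonedaH (HObj (HdObj X)))) W.1 := by
  refine Presheaf.ext' fun t τ => ?_
  refine Eq.trans ?_ (odot_lower_val _ W.1 τ).symm
  refine ((fullyFaithful_inclHd X).odot_upper_val V.1 τ).symm.trans (Eq.trans ?_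
    ((fullyFaithful_inclHd (HObj (HdObj X))).odot_upper_val W.1 _))
  refine (congrArg (fun P : Presheaf (PdObj X) s => P.val τ.1) h).trans
    ((doublePresheaf_mult_val W τ.1).trans (congrArg _ (Copresheaf.ext' fun q V => ?_)))
  rw [evHHd_val]
  exact ((fullyFaithful_inclHd X).odot_upper_val V.1 τ).trans
    (yoneda_hom (X := HdObj X) τ V.1).symm

theorem HdH_mult_eq {X : QCat Q} {s : Q} (W : (HdObj (HObj (HdObj (HObj X)))).fib s)
    (V : (HdObj (HObj X)).fib s)
    (h : QFunctor.map ((inclH Q ◫ inclHd Q).app X) V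
      = QFunctor.map ((inclH Q ◫ inclHd Q).app (HdObj (HObj X)) ≫
        (PFun Q ⋙ PdFun Q).map ((inclH Q ◫ inclHd Q).app X) ≫ (doubleCopresheaf Q).mult.app X) W) :
    V.1 = oplusVal (upperStar (coyonedaH (HObj X) ≫ yonedaH (HdObj (HObj X)))) W.1 := by
  refine Copresheaf.ext' fun t τ => ?_
  refine Eq.trans ?_ (oplus_upper_val _ W.1 τ).symm
  refine ((fullyFaithful_inclH X).oplus_lower_val V.1 τ).symm.trans (Eq.trans ?_
    ((fullyFaithful_inclH (HdObj (HObj X))).oplus_lower_val W.1 _))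
  refine (congrArg (fun P : Copresheaf (PObj X) s => P.val τ.1) h).trans
    ((doubleCopresheaf_mult_val W τ.1).trans (congrArg _ (Presheaf.ext' fun q V => ?_)))
  rw [evHdH_val]
  exact ((fullyFaithful_inclH X).oplus_lower_val V.1 τ).trans
    (coyoneda_hom (X := HObj X) V.1 τ).symm

/-! ### Flatness of the minimal extensions of the Hausdorff functors -/

theorem isFlatLaxExtension_HFun : IsFlatLaxExtension (HFun Q) (barExt (HFun Q)) :=
  isFlatLaxExtension_barExt HFun_mono fun X => (fullyFaithful_yoneda X).HFun_map

theorem isFlatLaxExtension_HdFun : IsFlatLaxExtension (HdFun Q) (barExt (HdFun Q)) :=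
  isFlatLaxExtension_barExt HdFun_mono fun X => (fullyFaithful_yoneda X).HdFun_map

theorem isFlatLaxExtension_HHd :
    IsFlatLaxExtension (HdFun Q ⋙ HFun Q) (barExt (HdFun Q ⋙ HFun Q)) :=
  isFlatLaxExtension_barExt (fun f g h => HFun_mono _ _ (HdFun_mono f g h))
    fun X => (fullyFaithful_yoneda X).HdFun_map.HFun_map

theorem isFlatLaxExtension_HdH :
    IsFlatLaxExtension (HFun Q ⋙ HdFun Q) (barExt (HFun Q ⋙ HdFun Q)) :=
  isFlatLaxExtension_barExt (fun f g h => HdFun_mono _ _ (HFun_mono f g h))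
    fun X => (fullyFaithful_yoneda X).HFun_map.HdFun_map

end QEnr

theorem mainTheorem2 {Q : Type u} [Quantaloid Q] (hQ : IsCompletelyDistributive Q) :
    (∃ M : TwoMonad (HdFun Q ⋙ HFun Q),
      -- `(ℋℋ†, 𝔰, 𝔶)` is a sub-2-monad of `(𝒫𝒫†, 𝔰, 𝔶)` via the inclusions `ℋ → 𝒫`, `ℋ† → 𝒫†`
      IsSubTwoMonad M (doublePresheaf Q) (inclHd Q ◫ inclH Q) ∧
      -- its unit is `y_{ℋ†X} · y†_X`
      (∀ X : QCat Q, M.unit.app X = coyonedaH X ≫ yonedaH (HdObj X)) ∧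
      -- its multiplication is `Υ ↦ Υ ∘ (y†_{ℋℋ†X} · y_{ℋ†X})_*`
      (∀ (X : QCat Q) (s : Q) (Υ : (HObj (HdObj (HObj (HdObj X)))).fib s),
        (QFunctor.map (M.mult.app X) Υ : (HObj (HdObj X)).fib s).1 =
          odotVal (lowerStar (yonedaH (HdObj X) ≫ coyonedaH (HObj (HdObj X)))) Υ.1) ∧
      -- the minimal extension is a lax extension of the 2-monad, it is flat,
      -- and it is the only flat lax extension
      IsMonadLaxExtension M (barExt (HdFun Q ⋙ HFun Q)) ∧
      IsFlatLaxExtension (HdFun Q ⋙ HFun Q) (barExt (HdFun Q ⋙ HFun Q)) ∧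
      (∀ E : DistMap (HdFun Q ⋙ HFun Q), IsFlatLaxExtension (HdFun Q ⋙ HFun Q) E →
        E = barExt (HdFun Q ⋙ HFun Q)) ∧
      -- it is the composite of the minimal extensions of `ℋ` and `ℋ†`
      (∀ (X Y : QCat Q) (φ : QDist X Y),
        barExt (HdFun Q ⋙ HFun Q) X Y φ =
          barExt (HFun Q) (HdObj X) (HdObj Y) (barExt (HdFun Q) X Y φ))) ∧
    (∃ M : TwoMonad (HFun Q ⋙ HdFun Q),
      IsSubTwoMonad M (doubleCopresheaf Q) (inclH Q ◫ inclHd Q) ∧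
      (∀ X : QCat Q, M.unit.app X = yonedaH X ≫ coyonedaH (HObj X)) ∧
      (∀ (X : QCat Q) (s : Q) (Υ : (HdObj (HObj (HdObj (HObj X)))).fib s),
        (QFunctor.map (M.mult.app X) Υ : (HdObj (HObj X)).fib s).1 =
          oplusVal (upperStar (coyonedaH (HObj X) ≫ yonedaH (HdObj (HObj X)))) Υ.1) ∧
      IsMonadLaxExtension M (barExt (HFun Q ⋙ HdFun Q)) ∧
      IsFlatLaxExtension (HFun Q ⋙ HdFun Q) (barExt (HFun Q ⋙ HdFun Q)) ∧
      (∀ E : DistMap (HFun Q ⋙ HdFun Q), IsFlatLaxExtension (HFun Q ⋙ HdFun Q) E →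
        E = barExt (HFun Q ⋙ HdFun Q)) ∧
      (∀ (X Y : QCat Q) (φ : QDist X Y),
        barExt (HFun Q ⋙ HdFun Q) X Y φ =
          barExt (HdFun Q) (HObj X) (HObj Y) (barExt (HFun Q) X Y φ))) := by
  constructor
  · obtain ⟨M, hM, hu, hm⟩ := exists_isSubTwoMonad (doublePresheaf Q) (inclHd Q ◫ inclH Q)
      fullyFaithful_inclHd_inclH objInjective_inclHd_inclH
      (fun X => coyonedaH X ≫ yonedaH (HdObj X))
      -- The units agree because pushforward along the inclusion sends representables to
      -- representables.
      (fun X => hom_ext fun q x => PFun_map_yoneda ((inclHd Q).app X) (QFunctor.map (coyonedaH X) x))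
      (exists_HHd_mult hQ)
    exact ⟨M, hM, hu, fun X s W => HHd_mult_eq W _
        (congrArg (fun k : HObj (HdObj (HObj (HdObj X))) ⟶ PObj (PdObj X) => QFunctor.map k W) (hm X)),
      isMonadLaxExtension_barExt M isFlatLaxExtension_HHd, isFlatLaxExtension_HHd,
      -- The composition formula needs flatness of the outer functor only, here `HFun`.
      fun E hE => hE.eq_barExt, fun X Y φ => barExt_comp isFlatLaxExtension_HFun φ⟩
  · obtain ⟨M, hM, hu, hm⟩ := exists_isSubTwoMonad (doubleCopresheaf Q) (inclH Q ◫ inclHd Q)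
      fullyFaithful_inclH_inclHd objInjective_inclH_inclHd
      (fun X => yonedaH X ≫ coyonedaH (HObj X))
      (fun X => hom_ext fun q x => PdFun_map_coyoneda ((inclH Q).app X) (QFunctor.map (yonedaH X) x))
      (exists_HdH_mult hQ)
    exact ⟨M, hM, hu, fun X s W => HdH_mult_eq W _
        (congrArg (fun k : HdObj (HObj (HdObj (HObj X))) ⟶ PdObj (PObj X) => QFunctor.map k W) (hm X)),
      isMonadLaxExtension_barExt M isFlatLaxExtension_HdH, isFlatLaxExtension_HdH,
      fun E hE => hE.eq_barExt, fun X Y φ => barExt_comp isFlatLaxExtension_HdFun φ⟩
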